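/- **Models.** Consider a floating-base robot with generalized coordinates $q\in\mathbb R^{n+6}$ (the first three being the world position of the base), consisting of rigid links with smooth kinematics, with total mass $m$, mass matrix $M(q)$, Coriolis matrix $C(q,\dot q)$ (from the Christoffel symbols of $M$), gravity torque $\tau_g(q)$, center of mass $x_{com}(q)$, CoM Jacobian $J(q)$, and $\Lambda=(JM^{-1}J^T)^{-1}$. With gravitational acceleration $g>0$ and height $h>0$ let * $\Sigma_1$ (whole body): $M\ddot q+C\dot q+\tau_g=u_1+\tau_{ext}$, $x_1=(q,\dot q)$, $y_1=x_{com}(q)$, with disturbance $\tau_{ext}$; * $\Sigma_2$ (CoM): $\dot x_2=u_2$, $y_2=x_2\in\mathbb R^3$; * $\Sigma_3$ (LIP): $x_3=(p,v)\in\mathbb R^6$, $\dot p=v$, $\dot v_{x,y}=\frac gh(p_{x,y}-u_3)$, $\dot v_z=0$, $y_3=p$. Solutions are absolutely continuous. For a whole-body system $\Sigma_1$ with state set $\mathcal X_1$ and disturbance set $\mathcal D$, a relation $\mathcal R$ is a *robust approximate simulation relation of precision $\epsilon$ between $\Sigma_1$ and $\Sigma_3$* if for all $(x_1^0,x_3^0)\in\mathcal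 R$: $\|y_1^0-y_3^0\|\le\epsilon$, and for every measurable disturbance signal with values in $\mathcal D$ and every trajectory $x_3(\cdot)$ of $\Sigma_3$ from $x_3^0$ there is a trajectory $x_1(\cdot)$ of $\Sigma_1$ from $x_1^0$ with $(x_1(t),x_3(t))\in\mathcal R$ for all $t\ge0$; similarly for $\Sigma_2$ and $\Sigma_3$ (without disturbance). **Assumptions.** Let $\mathcal X_1$, $\mathcal X_2$ be nonempty compact sets of states of $\Sigma_1$, $\Sigma_2$, with $M(q)\succ0$ on $\mathcal X_1$; let $\mathcal D$ (disturbances) and $\mathcal U_2$ (inputs of $\Sigma_2$) be nonempty and bounded; let $\mathcal X_3,\mathcal U_3$ be the state and input sets of $\Sigma_3$. Let $\kappa>0$, let $K_D\succ0$ be symmetric, let $0<\alpha<1/\sqrt{\kappa m/2}$ with $\frac1\kappa K_D-\alpha J^T\Lambda J\succeq\alpha M$ on $\mathcal X_1$, let $K\in\mathbb R^{3\times3}$ be Hurwitz, and let $\epsilon_2>0$. Use the interfaces $$u_1=\tau_g-2\kappa J^T(y_1-y_2)-K_D(\dot q-J^Tu_2),\qquad u_2=v+K(x_2-p),$$ and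 assume that $u_2=v+K(x_2-p)\in\mathcal U_2$ whenever $x_2\in\mathcal X_2$, $(p,v)\in\mathcal X_3$ and $\|x_2-p\|\le\epsilon_2$. Put $e=y_1-y_2$ and $$P(q)=\begin{bmatrix}\frac1{2\kappa}M&\frac\alpha2J^T\Lambda\\ \frac\alpha2\Lambda J&I\end{bmatrix},\qquad \mathcal V(x_1,x_2)=\begin{bmatrix}\dot q\\ e\end{bmatrix}^TP(q)\begin{bmatrix}\dot q\\ e\end{bmatrix},\qquad OT=z_1^Te+z_2^Tu_2+\tfrac1\kappa\dot q^T\tau_{ext},$$ $$z_1^T=-2u_2^T+\alpha\dot q^T\dot J^T\Lambda+\alpha(u_2^TJ-\dot q^T)K_DM^{-1}J^T\Lambda+\alpha(\tau_{ext}^T-\dot q^TC^T)M^{-1}J^T\Lambda+2\alpha^2\kappa\,\dot q^TJ^T\Lambda,$$ $$z_2^T=\tfrac1\kappa\dot q^TK_DJ^T-\alpha\dot q^TJ^T\Lambda.$$ **Theorem.** The minimal eigenvalue $\beta$ of $P(q)$ over $\mathcal X_1$ exists and is positive, and the supremum $S$ of $OT$ over $\mathcal X_1\times\mathcal X_2\times\mathcal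 U_2\times\mathcal D$ is finite. Let $$\mathcal R_{12}=\{(x_1,x_2)\in\mathcal X_1\times\mathcal X_2:\ \mathcal V(x_1,x_2)\le \tfrac{S}{2\alpha\kappa}\},\qquad \epsilon_1=\sqrt{\tfrac1\beta\,\tfrac{S}{2\alpha\kappa}}.$$ $\mathcal R_{12}$ contains $((q,0),x_{com}(q))$ whenever $(q,0)\in\mathcal X_1$ and $x_{com}(q)\in\mathcal X_2$. There is a relation $\mathcal R_{23}$ that contains, for some $\delta>0$, all $(x_2,x_3)$ with $\|y_2-y_3\|\le\delta$, that is an approximate simulation relation of precision $\epsilon_2$ between $\Sigma_2$ and $\Sigma_3$ and is preserved under the interface for $u_2$, such that the following hold. 1. Let $(x_1^0,x_2^0)\in\mathcal R_{12}$ and $(x_2^0,x_3^0)\in\mathcal R_{23}$, let $x_3(\cdot)$ be a trajectory of $\Sigma_3$ from $x_3^0$ in $\mathcal X_3$ with inputs in $\mathcal U_3$, and let $\tau_{ext}(\cdot)$ be a measurable signal with values in $\mathcal D$. Every solution $(x_1,x_2)$ from $(x_1^0,x_2^0)$ of the closed loop under the two interfaces that is constrained to $\mathcal X_1\times\mathcal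 X_2$ on $[0,T]$ satisfies, on $[0,T]$, $(x_1,x_2)\in\mathcal R_{12}$, $(x_2,x_3)\in\mathcal R_{23}$, $\|y_1-y_2\|\le\epsilon_1$, $\|y_2-y_3\|\le\epsilon_2$ and $\|y_1-y_3\|\le\epsilon_1+\epsilon_2$. If no closed-loop solution from $(x_1^0,x_2^0)$ leaves $\mathcal X_1\times\mathcal X_2$, then a closed-loop solution exists for all $t\ge0$. 2. Consequently $\Sigma_1$ robustly approximately simulates $\Sigma_3$: if the closed loop is constrained to $\mathcal X_1\times\mathcal X_2$ (for all initial data, trajectories $x_3$ and disturbances as in 1, no solution leaves this set), then the composition $\{(x_1,x_3):\exists x_2,\ (x_1,x_2)\in\mathcal R_{12},\ (x_2,x_3)\in\mathcal R_{23}\}$ is a robust approximate simulation relation between $\Sigma_1$ and $\Sigma_3$ of precision $\epsilon_1+\epsilon_2$. -/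

import Mathlib

open Set MeasureTheory
open scoped Matrix ContDiff

noncomputable section

/-! ### Control systems, trajectories, approximate simulation -/

/-- A control system `x' = f (x, u, d)`, `y = g x` with a state set, an input set and a
disturbance set. -/
structure ControlSystem (X U W Y : Type*) where
  f : X → U → W → X
  g : X → Y
  states : Set X
  inputs : Set U
  disturbances : Set W

/-- `x` is a (Carathéodory) state trajectory of `S` on the time interval `I` (an interval that
starts at `0`) under the input signal `u` and the disturbance signal `d`: the states, inputs and
disturbances lie in their sets, and `x t = x 0 + ∫₀ᵗ f (x, u, d)`. -/
def ControlSystem.IsTrajectoryOn {X U W Y : Type*} [NormedAddCommGroup X] [NormedSpace ℝ X]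
    (S : ControlSystem X U W Y) (I : Set ℝ) (u : ℝ → U) (d : ℝ → W) (x : ℝ → X) : Prop :=
  ∀ t ∈ I, x t ∈ S.states ∧ u t ∈ S.inputs ∧ d t ∈ S.disturbances ∧
    IntervalIntegrable (fun s => S.f (x s) (u s) (d s)) volume 0 t ∧
    x t = x 0 + ∫ s in (0 : ℝ)..t, S.f (x s) (u s) (d s)

/-- An admissible disturbance signal: measurable with values in `D`. -/
def IsDisturbanceSignal {W : Type*} [MeasurableSpace W] (D : Set W) (d : ℝ → W) : Prop :=
  Measurable d ∧ ∀ t, 0 ≤ t → d t ∈ D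

/-- `R` is a robust approximate simulation relation of precision `ε` between `S₁` and `S₂`
(`S₁`, which is subject to disturbances, robustly approximately simulates `S₂`, which is not). -/
def IsRobustApproxSimRel {X₁ X₂ U₁ U₂ W Y : Type*}
    [NormedAddCommGroup X₁] [NormedSpace ℝ X₁] [NormedAddCommGroup X₂] [NormedSpace ℝ X₂]
    [NormedAddCommGroup Y] [MeasurableSpace W]
    (S₁ : ControlSystem X₁ U₁ W Y) (S₂ : ControlSystem X₂ U₂ Unit Y)
    (R : X₁ → X₂ → Prop) (ε : ℝ) : Prop :=
  ∀ x₁₀ x₂₀, R x₁₀ x₂₀ →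
    ‖S₁.g x₁₀ - S₂.g x₂₀‖ ≤ ε ∧
    ∀ d, IsDisturbanceSignal S₁.disturbances d →
      ∀ u₂ x₂, S₂.IsTrajectoryOn (Ici 0) u₂ (fun _ => ()) x₂ → x₂ 0 = x₂₀ →
        ∃ u₁ x₁, S₁.IsTrajectoryOn (Ici 0) u₁ d x₁ ∧ x₁ 0 = x₁₀ ∧
          ∀ t, 0 ≤ t → R (x₁ t) (x₂ t)

/-! ### Floating-base rigid multibody systems -/

/-- Index set of the `n + 6` generalized coordinates of a floating-base robot: the world position
of the base (`Fin 3`), then the base orientation and joint coordinates (`Fin (n + 3)`). -/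
abbrev Coord (n : ℕ) : Type := Fin 3 ⊕ Fin (n + 3)

/-- Configurations `q` (also velocities, generalized forces). -/
abbrev Conf (n : ℕ) : Type := Coord n → ℝ

/-- Vectors of physical space. -/
abbrev V3 : Type := Fin 3 → ℝ

/-- The output space, with the Euclidean norm. -/
abbrev Y3 : Type := EuclideanSpace ℝ (Fin 3)

/-- A floating-base robot with `n + 6` generalized coordinates that consists of `N` rigid links.
Link `i` has mass `mass i`, inertia tensor `inertia i` about its center of mass in its own frame,
orientation `rot i s` (link frame to world frame) and center of mass at `p + offset i s`, where
`q = (p, s)` with `p` the base position. Every floating-base kinematic tree is of this form. -/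
structure Robot (n N : ℕ) where
  mass : Fin N → ℝ
  mass_pos : ∀ i, 0 < mass i
  inertia : Fin N → Matrix (Fin 3) (Fin 3) ℝ
  inertia_posSemidef : ∀ i, (inertia i).PosSemidef
  offset : Fin N → (Fin (n + 3) → ℝ) → V3
  offset_smooth : ∀ i, ContDiff ℝ ∞ (offset i)
  rot : Fin N → (Fin (n + 3) → ℝ) → Matrix (Fin 3) (Fin 3) ℝ
  rot_mem : ∀ i s, rot i s ∈ Matrix.specialOrthogonalGroup (Fin 3) ℝ
  rot_smooth : ∀ i a b, ContDiff ℝ ∞ (fun s => rot i s a b)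

/-- Partial derivative `∂F/∂q_j`. -/
def pderiv {n : ℕ} (F : Conf n → ℝ) (j : Coord n) (q : Conf n) : ℝ :=
  fderiv ℝ F q (Pi.single j 1)

/-- The vector of a skew-symmetric `3 × 3` matrix (inverse of `ω ↦ [ω]ₓ`). -/
def vee (A : Matrix (Fin 3) (Fin 3) ℝ) : V3 := ![A 2 1, A 0 2, A 1 0]

namespace Robot

variable {n N : ℕ} (rob : Robot n N)

/-- World position of the center of mass of link `i`. -/
def linkPos (i : Fin N) (q : Conf n) : V3 :=
  (fun k => q (Sum.inl k)) + rob.offset i (fun j => q (Sum.inr j))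

/-- World orientation of link `i`. -/
def linkRot (i : Fin N) (q : Conf n) : Matrix (Fin 3) (Fin 3) ℝ :=
  rob.rot i (fun j => q (Sum.inr j))

/-- Linear velocity Jacobian of link `i`. -/
def linJac (i : Fin N) (q : Conf n) : Matrix (Fin 3) (Coord n) ℝ :=
  Matrix.of fun k j => pderiv (fun q' => rob.linkPos i q' k) j q

/-- Angular velocity Jacobian of link `i` in the link frame, from `[ω]ₓ = Rᵀ R'`. -/
def angJac (i : Fin N) (q : Conf n) : Matrix (Fin 3) (Coord n) ℝ :=
  Matrix.of fun k j =>
    vee ((rob.linkRot i q)ᵀ * Matrix.of fun a b => pderiv (fun q' => rob.linkRot i q' a b) j q) k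

/-- Total mass `m`. -/
def totalMass : ℝ := ∑ i, rob.mass i

/-- Mass matrix `M(q)`: the kinetic energy is `½ q'ᵀ M(q) q'`. -/
def massMatrix (q : Conf n) : Matrix (Coord n) (Coord n) ℝ :=
  ∑ i, (rob.mass i • ((rob.linJac i q)ᵀ * rob.linJac i q) +
    (rob.angJac i q)ᵀ * rob.inertia i * rob.angJac i q)

/-- Coriolis matrix `C(q, v)`, through the Christoffel symbols of `M`. -/
def coriolis (q v : Conf n) : Matrix (Coord n) (Coord n) ℝ :=
  Matrix.of fun i j => ∑ k, (1 / 2 : ℝ) *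
    (pderiv (fun q' => rob.massMatrix q' i j) k q + pderiv (fun q' => rob.massMatrix q' i k) j q
      - pderiv (fun q' => rob.massMatrix q' j k) i q) * v k

/-- Gravitational torque `τ_g(q)`: gradient of the potential energy `∑ mᵢ g zᵢ`. -/
def gravityTorque (grav : ℝ) (q : Conf n) : Conf n :=
  fun j => pderiv (fun q' => ∑ i, rob.mass i * grav * rob.linkPos i q' 2) j q

/-- Center of mass `x_com(q)`. -/
def com (q : Conf n) : V3 := (1 / rob.totalMass) • ∑ i, rob.mass i • rob.linkPos i q

/-- Center of mass Jacobian `J(q)`. -/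
def comJac (q : Conf n) : Matrix (Fin 3) (Coord n) ℝ :=
  Matrix.of fun k j => pderiv (fun q' => rob.com q' k) j q

/-- Time derivative `J'` of the center of mass Jacobian at the state `(q, v)`. -/
def comJacDot (q v : Conf n) : Matrix (Fin 3) (Coord n) ℝ :=
  Matrix.of fun k j => ∑ l, pderiv (fun q' => rob.comJac q' k j) l q * v l

/-- Task-space inertia matrix `Λ = (J M⁻¹ Jᵀ)⁻¹`. -/
def taskInertia (q : Conf n) : Matrix (Fin 3) (Fin 3) ℝ :=
  (rob.comJac q * (rob.massMatrix q)⁻¹ * (rob.comJac q)ᵀ)⁻¹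

end Robot

/-! ### The three models -/

/-- Whole-body model: state `(q, q')`, input `u₁` (the generalized force
`Sᵀ τ + ∑ J_cᵀ f_c` of the joint torques and contact forces), disturbance `τ_ext`, dynamics
`M q'' + C q' + τ_g = u₁ + τ_ext`, output `x_com(q)`. -/
def wholeBodyModel {n N : ℕ} (rob : Robot n N) (grav : ℝ) (X₁ : Set (Conf n × Conf n))
    (D : Set (Conf n)) : ControlSystem (Conf n × Conf n) (Conf n) (Conf n) Y3 where
  f x u d := (x.2, (rob.massMatrix x.1)⁻¹ *ᵥ
    (u + d - rob.coriolis x.1 x.2 *ᵥ x.2 - rob.gravityTorque grav x.1))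
  g x := WithLp.toLp 2 (rob.com x.1)
  states := X₁
  inputs := univ
  disturbances := D

/-- Center of mass model: `x₂' = u₂`, `y₂ = x₂`. -/
def comModel : ControlSystem V3 V3 Unit Y3 where
  f _ u _ := u
  g x := WithLp.toLp 2 x
  states := univ
  inputs := univ
  disturbances := univ

/-- States `(p, v)` of the linear inverted pendulum. -/
abbrev LipState : Type := Fin 3 ⊕ Fin 3 → ℝ

/-- Position of a pendulum state. -/
def lipPos (x : LipState) : V3 := fun k => x (Sum.inl k)

/-- Velocity of a pendulum state. -/
def lipVel (x : LipState) : V3 := fun k => x (Sum.inr k)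

/-- `A_lip`: `p' = v`, and `v' = (g/h) p` in the horizontal directions. -/
def lipA (grav h : ℝ) : Matrix (Fin 3 ⊕ Fin 3) (Fin 3 ⊕ Fin 3) ℝ :=
  Matrix.fromBlocks 0 1 (Matrix.diagonal ![grav / h, grav / h, 0]) 0

/-- `B_lip`: the center of pressure `u₃` enters as `- (g/h) u₃` in the horizontal directions. -/
def lipB (grav h : ℝ) : Matrix (Fin 3 ⊕ Fin 3) (Fin 2) ℝ :=
  Matrix.fromRows 0 ((-(grav / h)) • !![1, 0; 0, 1; 0, 0])

/-- `C_lip`: the output is the position. -/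
def lipC : Matrix (Fin 3) (Fin 3 ⊕ Fin 3) ℝ := Matrix.fromCols 1 0

/-- Linear inverted pendulum model of height `h`; the input `u₃` is the center of pressure. -/
def lipModel (grav h : ℝ) (X₃ : Set LipState) (U₃ : Set (Fin 2 → ℝ)) :
    ControlSystem LipState (Fin 2 → ℝ) Unit Y3 where
  f x u _ := lipA grav h *ᵥ x + lipB grav h *ᵥ u
  g x := WithLp.toLp 2 (lipC *ᵥ x)
  states := X₃
  inputs := U₃
  disturbances := univ

/-! ### The interfaces and the closed loop -/

/-- Interface `u₂ = v_lip + K (x₂ - p_lip)`. -/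
def lipInterface (K : Matrix (Fin 3) (Fin 3) ℝ) (x₂ : V3) (x₃ : LipState) : V3 :=
  lipVel x₃ + K *ᵥ (x₂ - lipPos x₃)

/-- `K` is Hurwitz: every complex eigenvalue has negative real part. -/
def IsHurwitz (K : Matrix (Fin 3) (Fin 3) ℝ) : Prop :=
  ∀ z ∈ spectrum ℂ (K.map Complex.ofReal), z.re < 0

section EnergyShaping

variable {n N : ℕ} (rob : Robot n N)

/-- Energy shaping interface `u₁ = τ_g - 2 κ Jᵀ (y₁ - y₂) - K_D (q' - Jᵀ u₂)`. -/
def energyInterface (grav κ : ℝ) (KD : Matrix (Coord n) (Coord n) ℝ)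
    (x₁ : Conf n × Conf n) (x₂ u₂ : V3) : Conf n :=
  rob.gravityTorque grav x₁.1
    - (2 * κ) • ((rob.comJac x₁.1)ᵀ *ᵥ (rob.com x₁.1 - x₂))
    - KD *ᵥ (x₁.2 - (rob.comJac x₁.1)ᵀ *ᵥ u₂)

/-- The block matrix `P(q)` of the Lyapunov-like function. -/
def lyapMatrix (κ α : ℝ) (q : Conf n) : Matrix (Coord n ⊕ Fin 3) (Coord n ⊕ Fin 3) ℝ :=
  Matrix.fromBlocks
    ((1 / (2 * κ)) • rob.massMatrix q)
    ((α / 2) • ((rob.comJac q)ᵀ * rob.taskInertia q))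
    ((α / 2) • (rob.taskInertia q * rob.comJac q))
    1

/-- The Lyapunov-like function `𝒱(x₁, x₂)`. -/
def lyapFn (κ α : ℝ) (x₁ : Conf n × Conf n) (x₂ : V3) : ℝ :=
  let w : Coord n ⊕ Fin 3 → ℝ := Sum.elim x₁.2 (rob.com x₁.1 - x₂)
  w ⬝ᵥ lyapMatrix rob κ α x₁.1 *ᵥ w

/-- The residual terms `OT` in the estimate `𝒱' ≤ - 2 α κ 𝒱 + OT` along the closed loop. -/
def otherTerms (κ α : ℝ) (KD : Matrix (Coord n) (Coord n) ℝ)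
    (x₁ : Conf n × Conf n) (x₂ u₂ : V3) (τ : Conf n) : ℝ :=
  let v := x₁.2
  let J := rob.comJac x₁.1
  let Mi := (rob.massMatrix x₁.1)⁻¹
  let L := rob.taskInertia x₁.1
  let z₁ : V3 := (-2 : ℝ) • u₂ + α • (v ᵥ* ((rob.comJacDot x₁.1 v)ᵀ * L))
    + α • ((u₂ ᵥ* J - v) ᵥ* (KD * Mi * Jᵀ * L))
    + α • ((τ - v ᵥ* (rob.coriolis x₁.1 v)ᵀ) ᵥ* (Mi * Jᵀ * L))
    + (2 * α ^ 2 * κ) • (v ᵥ* (Jᵀ * L))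
  let z₂ : V3 := (1 / κ) • (v ᵥ* (KD * Jᵀ)) - α • (v ᵥ* (Jᵀ * L))
  z₁ ⬝ᵥ (rob.com x₁.1 - x₂) + z₂ ⬝ᵥ u₂ + (1 / κ) * (v ⬝ᵥ τ)

/-- `x₁`, `x₂` evolve on `[0, T]` in closed loop: the whole-body model under the energy shaping
interface and the disturbance `d`, the center of mass model under the linear interface driven by
the pendulum trajectory `x₃`. No state constraint is imposed here. -/
def IsClosedLoopOn (grav κ : ℝ) (KD : Matrix (Coord n) (Coord n) ℝ) (K : Matrix (Fin 3) (Fin 3) ℝ)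
    (I : Set ℝ) (x₃ : ℝ → LipState) (d : ℝ → Conf n)
    (x₁ : ℝ → Conf n × Conf n) (x₂ : ℝ → V3) : Prop :=
  (wholeBodyModel rob grav univ univ).IsTrajectoryOn I
    (fun t => energyInterface rob grav κ KD (x₁ t) (x₂ t) (lipInterface K (x₂ t) (x₃ t))) d x₁ ∧
  comModel.IsTrajectoryOn I (fun t => lipInterface K (x₂ t) (x₃ t)) (fun _ => ()) x₂

/-- For the pendulum trajectory `x₃` and the disturbance `d`, the closed loop started at
`(x₁₀, x₂₀)` is constrained to `X₁ × X₂`: it never leaves this set as long as it is defined. -/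
def IsConstrained (grav κ : ℝ) (KD : Matrix (Coord n) (Coord n) ℝ) (K : Matrix (Fin 3) (Fin 3) ℝ)
    (X₁ : Set (Conf n × Conf n)) (X₂ : Set V3) (x₃ : ℝ → LipState) (d : ℝ → Conf n)
    (x₁₀ : Conf n × Conf n) (x₂₀ : V3) : Prop :=
  ∀ T, 0 ≤ T → ∀ x₁ x₂, IsClosedLoopOn rob grav κ KD K (Icc 0 T) x₃ d x₁ x₂ →
    x₁ 0 = x₁₀ → x₂ 0 = x₂₀ → ∀ t ∈ Icc 0 T, x₁ t ∈ X₁ ∧ x₂ t ∈ X₂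

/-- The sublevel set `{𝒱 ≤ S / (2 α κ)}` in `X₁ × X₂`, as a relation. -/
def lyapRel (κ α S : ℝ) (X₁ : Set (Conf n × Conf n)) (X₂ : Set V3)
    (x₁ : Conf n × Conf n) (x₂ : V3) : Prop :=
  x₁ ∈ X₁ ∧ x₂ ∈ X₂ ∧ lyapFn rob κ α x₁ x₂ ≤ S / (2 * α * κ)

end EnergyShaping

end

noncomputable section

open Filter Topology

/-! ### Absolutely continuous curves and differential inequalities -/

/-! Translating the base moves every link rigidly without rotating it. If `E` (`baseIncl`) collects
the velocities of these translations, then `J E = 1` and `M E = m Jᵀ`, hence `M⁻¹ Jᵀ = m⁻¹ E` and `Λ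
= m · 1`. So `Λ` is constant along trajectories, its time derivative never enters, and every inverse
of `M` disappears from `𝒱` and from `OT` (`lyapFn_eq`, `otherTerms_eq`).

The splitting `v = E (J v) + y` is orthogonal for `M`. Completing a square in `e` then shows that
the bound on `α` makes `P` positive definite (`lyapQuad_pos`). Minimizing its quadratic form over
the compact product of `X₁` with the unit sphere gives `β`. The reduced `OT` is continuous, so its
supremum is finite. Along the closed loop, `2 α κ 𝒱 + 𝒱' - OT` is exactly minus the quadratic form
of `(1/κ) K_D - α Jᵀ Λ J - α M` at the velocity (`deriv_lyapQuad_le`). While the states stay in `X₁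
× X₂` and `u₂` in `U₂`, one has `OT ≤ S`, and a comparison principle for absolutely continuous
functions keeps `𝒱` below `S / (2 α κ)` (`lyapFn_le_of_isClosedLoopOn`).

For the other pair of models, the interface makes `z = x₂ - p` solve `z' = K z` whatever the
pendulum input is, so `z t = exp (t K) z 0`. The relation `lipRel` asks that this whole future orbit
stay within `ε₂`. It is invariant by the semigroup law, and it contains a ball because the
exponential of a Hurwitz matrix is bounded (`IsHurwitz.exists_norm_exp_mulVec_le`). Precision `ε₂`
also places `u₂` in `U₂`, which is what the estimate on `OT` needs. The triangle inequality composes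
the two precisions.

Global existence is subtle only because the whole-body field may be singular away from `X₁`. The
field is replaced by a globally Lipschitz one that agrees with it on a compact neighborhood of `X₁`.
Picard iteration solves the modified equation, and the constraint hypothesis prevents its solution
from ever leaving `X₁`, where nothing was modified (`exists_isClosedLoopOn_Ici`). -/

/-- A curve whose increments are controlled by those of an absolutely continuous curve is
absolutely continuous. -/
theorem AbsolutelyContinuousOnInterval.of_dist_le {X Y : Type*} [PseudoMetricSpace X]
    [PseudoMetricSpace Y] {x : ℝ → X} {y : ℝ → Y} {a b C : ℝ}
    (hy : AbsolutelyContinuousOnInterval y a b)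
    (h : ∀ s ∈ uIcc a b, ∀ t ∈ uIcc a b, dist (x s) (x t) ≤ C * dist (y s) (y t)) :
    AbsolutelyContinuousOnInterval x a b := by
  have hmul := (Filter.Tendsto.const_mul C hy)
  rw [mul_zero] at hmul
  refine squeeze_zero' (Eventually.of_forall fun E => Finset.sum_nonneg fun _ _ => dist_nonneg)
    ?_ hmul
  refine eventually_inf_principal.2 (Eventually.of_forall fun E hE => ?_)
  rw [Finset.mul_sum]
  exact Finset.sum_le_sum fun i hi => h _ (hE.1 i hi).1 _ (hE.1 i hi).2

theorem AbsolutelyContinuousOnInterval.prodMk {X Y : Type*} [PseudoMetricSpace X]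
    [PseudoMetricSpace Y] {x : ℝ → X} {y : ℝ → Y} {a b : ℝ}
    (hx : AbsolutelyContinuousOnInterval x a b) (hy : AbsolutelyContinuousOnInterval y a b) :
    AbsolutelyContinuousOnInterval (fun t => (x t, y t)) a b := by
  have hadd := Filter.Tendsto.add hx hy
  rw [add_zero] at hadd
  refine squeeze_zero (fun E => Finset.sum_nonneg fun _ _ => dist_nonneg) (fun E => ?_) hadd
  rw [← Finset.sum_add_distrib]
  refine Finset.sum_le_sum fun i _ => ?_
  rw [Prod.dist_eq]
  exact max_le_add_of_nonneg dist_nonneg dist_nonneg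

/-- A `C¹` function of an absolutely continuous curve is absolutely continuous. -/
theorem ContDiff.comp_absolutelyContinuousOnInterval {E F : Type*} [NormedAddCommGroup E]
    [NormedSpace ℝ E] [NormedAddCommGroup F] [NormedSpace ℝ F] {Φ : E → F} (hΦ : ContDiff ℝ 1 Φ)
    {x : ℝ → E} {a b : ℝ} (hx : AbsolutelyContinuousOnInterval x a b) :
    AbsolutelyContinuousOnInterval (fun t => Φ (x t)) a b := by
  have hcomp : IsCompact (x '' uIcc a b) := isCompact_uIcc.image_of_continuousOn hx.continuousOn
  obtain ⟨C, hC⟩ := (hΦ.locallyLipschitz.locallyLipschitzOn).exists_lipschitzOnWith_of_compact hcomp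
  exact hx.of_dist_le (C := C) fun s hs t ht =>
    hC.dist_le_mul _ (mem_image_of_mem _ hs) _ (mem_image_of_mem _ ht)

/-- An indefinite integral is absolutely continuous. -/
theorem absolutelyContinuousOnInterval_of_eq_integral {E : Type*} [NormedAddCommGroup E]
    [NormedSpace ℝ E] {x f : ℝ → E} {T : ℝ} (hT : 0 ≤ T) (hf : IntervalIntegrable f volume 0 T)
    (hx : ∀ t ∈ Icc 0 T, x t = x 0 + ∫ s in (0 : ℝ)..t, f s) :
    AbsolutelyContinuousOnInterval x 0 T := by
  -- The increments of `x` are dominated by those of the primitive of `‖f‖`, which is a real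
  -- function.
  have hG := hf.norm.absolutelyContinuousOnInterval_intervalIntegral (c := 0) left_mem_uIcc
  refine hG.of_dist_le (C := 1) fun s hs t ht => ?_
  have hs' := intervalIntegrable_iff.1 hf
  have h0 : ∀ r ∈ uIcc 0 T, IntervalIntegrable f volume 0 r := fun r hr =>
    hf.mono_set (uIcc_subset_uIcc left_mem_uIcc hr)
  have hst : IntervalIntegrable f volume t s := (h0 t ht).symm.trans (h0 s hs)
  rw [uIcc_of_le hT] at hs ht
  rw [hx s hs, hx t ht, dist_add_left, dist_eq_norm, one_mul, dist_eq_norm,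
    intervalIntegral.integral_interval_sub_left (h0 s (by rwa [uIcc_of_le hT]))
      (h0 t (by rwa [uIcc_of_le hT])),
    intervalIntegral.integral_interval_sub_left (h0 s (by rwa [uIcc_of_le hT])).norm
      (h0 t (by rwa [uIcc_of_le hT])).norm]
  exact intervalIntegral.norm_integral_le_abs_integral_norm

/-- Lebesgue differentiation of the primitive. The two endpoints are discarded because `x` is known
to agree with the primitive on `[0, T]` only, while a two-sided derivative needs a neighborhood. -/
theorem ae_hasDerivAt_of_eq_integral {E : Type*} [NormedAddCommGroup E]
    [NormedSpace ℝ E] [CompleteSpace E] {x f : ℝ → E} {T : ℝ} (hT : 0 ≤ T)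
    (hf : IntervalIntegrable f volume 0 T)
    (hx : ∀ t ∈ Icc 0 T, x t = x 0 + ∫ s in (0 : ℝ)..t, f s) :
    ∀ᵐ t, t ∈ Icc 0 T → HasDerivAt x (f t) t := by
  have h₁ : ∀ᵐ t : ℝ, t ≠ 0 := by simp [ae_iff, measure_singleton]
  have h₂ : ∀ᵐ t : ℝ, t ≠ T := by simp [ae_iff, measure_singleton]
  filter_upwards [hf.ae_hasDerivAt_integral, h₁, h₂] with t ht ht0 htT hmem
  rw [uIcc_of_le hT] at ht
  have hd := (ht hmem 0 (left_mem_Icc.2 hT)).const_add (x 0)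
  refine hd.congr_of_eventuallyEq ?_
  filter_upwards [Ioo_mem_nhds (lt_of_le_of_ne hmem.1 (Ne.symm ht0)) (lt_of_le_of_ne hmem.2 htT)]
    with s hs using hx s (Ioo_subset_Icc_self hs)

/-- Comparison principle: `h' ≤ a (c - h)` almost everywhere and `h 0 ≤ c` give `h T ≤ c`. -/
theorem AbsolutelyContinuousOnInterval.le_of_ae_hasDerivAt_le {h : ℝ → ℝ} {T a c : ℝ}
    (hT : 0 ≤ T) (hh : AbsolutelyContinuousOnInterval h 0 T)
    (hd : ∀ᵐ t, t ∈ Icc 0 T → ∃ h', HasDerivAt h h' t ∧ h' ≤ a * (c - h t)) (h0 : h 0 ≤ c) :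
    h T ≤ c := by
  -- Integrating factor: `exp (a t) (h t - c)` has nonpositive derivative almost everywhere and is
  -- absolutely continuous, so it does not increase. The sign of `a` plays no role.
  have hexp : AbsolutelyContinuousOnInterval (fun t => Real.exp (a * t)) 0 T :=
    ContDiffOn.absolutelyContinuousOnInterval (by fun_prop)
  have hsub : AbsolutelyContinuousOnInterval (fun t => h t - c) 0 T :=
    hh.of_dist_le (C := 1) fun s _ t _ => by simp
  have hg := hexp.mul hsub
  have hint := hg.integral_deriv_eq_sub
  have hnonpos : ∫ t in (0 : ℝ)..T,
      deriv ((fun t => Real.exp (a * t)) * fun t => h t - c) t ≤ 0 := by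
    rw [intervalIntegral.integral_of_le hT]
    refine setIntegral_nonpos_ae measurableSet_Ioc ?_
    filter_upwards [hd] with t ht hmem
    obtain ⟨h', hh', hle⟩ := ht (Ioc_subset_Icc_self hmem)
    have he : HasDerivAt (fun t => Real.exp (a * t)) (Real.exp (a * t) * (a * 1)) t :=
      ((hasDerivAt_id t).const_mul a).exp
    rw [(he.mul (hh'.sub_const c)).deriv]
    have := Real.exp_pos (a * t)
    nlinarith
  rw [hint] at hnonpos
  simp only [Pi.mul_apply, mul_zero, Real.exp_zero, one_mul] at hnonpos
  have := Real.exp_pos (a * T)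
  by_contra! hc
  nlinarith [mul_pos this (sub_pos.2 hc)]

/-! ### Global solutions of Carathéodory equations -/

section Caratheodory

variable {E : Type*} [NormedAddCommGroup E] {F : ℝ → E → E} {x₀ : E}

/-- The continuous function `C + L ‖x s - x₀‖` dominates the integrand on the interval. -/
theorem intervalIntegrable_of_lipschitz_field
    (hmeas : ∀ x : ℝ → E, Continuous x → AEStronglyMeasurable (fun s => F s (x s)) volume)
    (hlip : ∀ T, ∃ L, ∀ t ≤ T, ∀ x y, ‖F t x - F t y‖ ≤ L * ‖x - y‖)
    (hbdd : ∀ T, ∃ C, ∀ t ≤ T, ‖F t x₀‖ ≤ C) {x : ℝ → E} (hx : Continuous x) (a b : ℝ) :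
    IntervalIntegrable (fun s => F s (x s)) volume a b := by
  obtain ⟨L, hL⟩ := hlip (max a b)
  obtain ⟨C, hC⟩ := hbdd (max a b)
  have hcont : Continuous fun s => C + L * ‖x s - x₀‖ := by fun_prop
  refine (hcont.intervalIntegrable a b).mono_fun (hmeas x hx).restrict ?_
  refine (ae_restrict_iff' measurableSet_uIoc).2 (Eventually.of_forall fun s hs => ?_)
  have hs' : s ≤ max a b := hs.2
  have h1 := hL s hs' (x s) x₀
  have h2 := hC s hs'
  have h3 : ‖F s (x s)‖ ≤ ‖F s (x s) - F s x₀‖ + ‖F s x₀‖ := by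
    simpa using norm_add_le (F s (x s) - F s x₀) (F s x₀)
  exact (by linarith : ‖F s (x s)‖ ≤ C + L * ‖x s - x₀‖).trans (le_abs_self _)

variable [NormedSpace ℝ E]

/-- The Picard iterates of `x' = F (t, x)`, `x 0 = x₀`. -/
def picardIterate (F : ℝ → E → E) (x₀ : E) : ℕ → ℝ → E
  | 0 => fun _ => x₀
  | k + 1 => fun t => x₀ + ∫ s in (0 : ℝ)..t, F s (picardIterate F x₀ k s)

theorem continuous_picardIterate
    (hmeas : ∀ x : ℝ → E, Continuous x → AEStronglyMeasurable (fun s => F s (x s)) volume)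
    (hlip : ∀ T, ∃ L, ∀ t ≤ T, ∀ x y, ‖F t x - F t y‖ ≤ L * ‖x - y‖)
    (hbdd : ∀ T, ∃ C, ∀ t ≤ T, ‖F t x₀‖ ≤ C) (k : ℕ) : Continuous (picardIterate F x₀ k) := by
  induction k with
  | zero => exact continuous_const
  | succ k ih =>
    exact continuous_const.add (intervalIntegral.continuous_primitive
      (fun a b => intervalIntegrable_of_lipschitz_field hmeas hlip hbdd ih a b) 0)

theorem picardIterate_of_nonpos (hneg : ∀ t < 0, ∀ x, F t x = 0) (k : ℕ) {t : ℝ} (ht : t ≤ 0) :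
    picardIterate F x₀ k t = x₀ := by
  cases k with
  | zero => rfl
  | succ k =>
    simp only [picardIterate, add_eq_left]
    -- The field vanishes at strictly negative times only, so the endpoint `0` is dropped from the
    -- domain first.
    rw [intervalIntegral.integral_of_ge ht, ← integral_Ico_eq_integral_Ioc,
      setIntegral_eq_zero_of_forall_eq_zero fun s hs => hneg s hs.2 _, neg_zero]

/-- In the norm weighted by `exp (-2 L t)` the Picard map contracts by the factor `1/2` on `[0, T]`,
however large `T` is. No gluing of short time intervals is needed. -/
theorem picardIterate_dist_le
    (hmeas : ∀ x : ℝ → E, Continuous x → AEStronglyMeasurable (fun s => F s (x s)) volume)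
    (hlip : ∀ T, ∃ L, ∀ t ≤ T, ∀ x y, ‖F t x - F t y‖ ≤ L * ‖x - y‖)
    (hbdd : ∀ T, ∃ C, ∀ t ≤ T, ‖F t x₀‖ ≤ C) (hneg : ∀ t < 0, ∀ x, F t x = 0) (T : ℝ) :
    ∃ A, ∀ t ≤ T, ∀ k,
      dist (picardIterate F x₀ k t) (picardIterate F x₀ (k + 1) t) ≤ A * (1 / 2) ^ k := by
  obtain ⟨L₀, hL₀⟩ := hlip T
  obtain ⟨C₀, hC₀⟩ := hbdd T
  set L := max L₀ 1
  have hLpos : 0 < L := lt_max_of_lt_right one_pos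
  have hL : ∀ t ≤ T, ∀ x y, ‖F t x - F t y‖ ≤ L * ‖x - y‖ := fun t ht x y =>
    (hL₀ t ht x y).trans (mul_le_mul_of_nonneg_right (le_max_left _ _) (norm_nonneg _))
  set C := max C₀ 0
  have hC : ∀ t ≤ T, ‖F t x₀‖ ≤ C := fun t ht => (hC₀ t ht).trans (le_max_left _ _)
  have hC0 : 0 ≤ C := le_max_right _ _
  have hint : ∀ k a b, IntervalIntegrable (fun s => F s (picardIterate F x₀ k s)) volume a b :=
    fun k a b => intervalIntegrable_of_lipschitz_field hmeas hlip hbdd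
      (continuous_picardIterate hmeas hlip hbdd k) a b
  have key : ∀ k, ∀ t, 0 ≤ t → t ≤ T →
      ‖picardIterate F x₀ (k + 1) t - picardIterate F x₀ k t‖
        ≤ C * |T| * (1 / 2) ^ k * Real.exp (2 * L * t) := by
    intro k
    induction k with
    | zero =>
      intro t h0 hT
      have h1 : ‖∫ s in (0 : ℝ)..t, F s x₀‖ ≤ C * |t - 0| :=
        intervalIntegral.norm_integral_le_of_norm_le_const fun s hs => by
          rw [uIoc_of_le h0] at hs
          exact hC s (hs.2.trans hT)
      simp only [picardIterate, add_sub_cancel_left, pow_zero, mul_one]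
      have h2 : |t - 0| ≤ |T| := by
        rw [sub_zero]; exact abs_le_abs_of_nonneg h0 hT
      have h3 : 1 ≤ Real.exp (2 * L * t) := Real.one_le_exp (by positivity)
      calc _ ≤ C * |t - 0| := h1
        _ ≤ C * |T| * 1 := by rw [mul_one]; gcongr
        _ ≤ _ := by gcongr
    | succ k ih =>
      intro t h0 hT
      have heq : picardIterate F x₀ (k + 1 + 1) t - picardIterate F x₀ (k + 1) t
          = ∫ s in (0 : ℝ)..t, (F s (picardIterate F x₀ (k + 1) s)
            - F s (picardIterate F x₀ k s)) := by
        rw [intervalIntegral.integral_sub (hint _ _ _) (hint _ _ _)]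
        simp only [picardIterate, add_sub_add_left_eq_sub]
      rw [heq]
      set D := C * |T| * (1 / 2) ^ k
      have hD : 0 ≤ D := by positivity
      have hprim : ∫ s in (0 : ℝ)..t, L * (D * Real.exp (2 * L * s))
          = D / 2 * (Real.exp (2 * L * t) - 1) := by
        have : ∀ s ∈ uIcc 0 t, HasDerivAt (fun s => D / 2 * Real.exp (2 * L * s))
            (L * (D * Real.exp (2 * L * s))) s := fun s _ => by
          have he : HasDerivAt (fun s => Real.exp (2 * L * s))
            (Real.exp (2 * L * s) * (2 * L * 1)) s := ((hasDerivAt_id s).const_mul (2 * L)).exp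
          exact (he.const_mul (D / 2)).congr_deriv (by ring)
        rw [intervalIntegral.integral_eq_sub_of_hasDerivAt this
          (Continuous.intervalIntegrable (by fun_prop) _ _)]
        simp only [mul_zero, Real.exp_zero]
        ring
      calc _ ≤ ∫ s in (0 : ℝ)..t, L * (D * Real.exp (2 * L * s)) := by
            refine intervalIntegral.norm_integral_le_of_norm_le h0
              (Eventually.of_forall fun s hs => ?_)
              (Continuous.intervalIntegrable (by fun_prop) _ _)
            refine (hL s (hs.2.trans hT) _ _).trans ?_
            gcongr
            exact ih s hs.1.le (hs.2.trans hT)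
        _ = D / 2 * (Real.exp (2 * L * t) - 1) := hprim
        _ ≤ D / 2 * Real.exp (2 * L * t) := by gcongr; linarith
        _ = _ := by simp only [D, pow_succ]; ring
  refine ⟨C * |T| * Real.exp (2 * L * |T|), fun t ht k => ?_⟩
  rcases le_total t 0 with h0 | h0
  · rw [picardIterate_of_nonpos hneg _ h0, picardIterate_of_nonpos hneg _ h0, dist_self]
    positivity
  · rw [dist_comm, dist_eq_norm]
    calc _ ≤ _ := key k t h0 ht
      _ ≤ C * |T| * (1 / 2) ^ k * Real.exp (2 * L * |T|) := by
        gcongr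
        exact ht.trans (le_abs_self _)
      _ = _ := by ring

/-- Global existence for a field that vanishes at negative times. -/
theorem exists_caratheodory_solution_of_eq_zero [CompleteSpace E]
    (hmeas : ∀ x : ℝ → E, Continuous x → AEStronglyMeasurable (fun s => F s (x s)) volume)
    (hlip : ∀ T, ∃ L, ∀ t ≤ T, ∀ x y, ‖F t x - F t y‖ ≤ L * ‖x - y‖)
    (hbdd : ∀ T, ∃ C, ∀ t ≤ T, ‖F t x₀‖ ≤ C) (hneg : ∀ t < 0, ∀ x, F t x = 0) :
    ∃ x : ℝ → E, Continuous x ∧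
      (∀ t, IntervalIntegrable (fun s => F s (x s)) volume 0 t) ∧
      ∀ t, 0 ≤ t → x t = x₀ + ∫ s in (0 : ℝ)..t, F s (x s) := by
  have hlim : ∀ t, ∃ l, Tendsto (fun k => picardIterate F x₀ k t) atTop (𝓝 l) := fun t => by
    obtain ⟨A, hA⟩ := picardIterate_dist_le hmeas hlip hbdd hneg t
    exact cauchySeq_tendsto_of_complete
      (cauchySeq_of_le_geometric (1 / 2) A (by norm_num) (hA t le_rfl))
  choose x hx using hlim
  have hrate : ∀ T, ∃ A, ∀ t ≤ T, ∀ k, dist (picardIterate F x₀ k t) (x t) ≤ A * (1 / 2) ^ k := by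
    intro T
    obtain ⟨A, hA⟩ := picardIterate_dist_le hmeas hlip hbdd hneg T
    refine ⟨A / (1 - 1 / 2), fun t ht k => ?_⟩
    have := dist_le_of_le_geometric_of_tendsto (1 / 2) A (by norm_num) (hA t ht) (hx t) k
    calc _ ≤ _ := this
      _ = _ := by ring
  have hpow : ∀ A : ℝ, Tendsto (fun k : ℕ => A * (1 / 2) ^ k) atTop (𝓝 0) := fun A => by
    simpa using (tendsto_pow_atTop_nhds_zero_of_lt_one (r := (1 / 2 : ℝ)) (by norm_num)
      (by norm_num)).const_mul A
  have hcont : Continuous x := by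
    -- The geometric rate is uniform on each half-line `t ≤ T`, which suffices for continuity of the
    -- limit.
    have hloc : TendstoLocallyUniformly (picardIterate F x₀) x atTop := by
      rw [Metric.tendstoLocallyUniformly_iff]
      intro ε hε t
      obtain ⟨A, hA⟩ := hrate (t + 1)
      refine ⟨Iic (t + 1), Iic_mem_nhds (by linarith), ?_⟩
      filter_upwards [(hpow A).eventually (gt_mem_nhds hε)] with k hk s hs
      rw [dist_comm]
      exact (hA s hs k).trans_lt hk
    exact hloc.continuous
      (Eventually.of_forall fun k => continuous_picardIterate hmeas hlip hbdd k).frequently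
  have hint : ∀ t, IntervalIntegrable (fun s => F s (x s)) volume 0 t := fun t =>
    intervalIntegrable_of_lipschitz_field hmeas hlip hbdd hcont 0 t
  refine ⟨x, hcont, hint, fun t ht => ?_⟩
  obtain ⟨L, hL⟩ := hlip t
  obtain ⟨A, hA⟩ := hrate t
  refine tendsto_nhds_unique ((tendsto_add_atTop_iff_nat 1).2 (hx t)) ?_
  simp only [picardIterate]
  refine Tendsto.const_add x₀ ?_
  rw [tendsto_iff_norm_sub_tendsto_zero]
  refine squeeze_zero (fun _ => norm_nonneg _) (fun k => ?_) (hpow (|L| * A * |t - 0|))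
  rw [← intervalIntegral.integral_sub (intervalIntegrable_of_lipschitz_field hmeas hlip hbdd
      (continuous_picardIterate hmeas hlip hbdd k) 0 t) (hint t)]
  have : ‖∫ s in (0 : ℝ)..t, (F s (picardIterate F x₀ k s) - F s (x s))‖
      ≤ |L| * (A * (1 / 2) ^ k) * |t - 0| := by
    refine intervalIntegral.norm_integral_le_of_norm_le_const fun s hs => ?_
    rw [uIoc_of_le ht] at hs
    calc _ ≤ L * ‖picardIterate F x₀ k s - x s‖ := hL s hs.2 _ _
      _ ≤ |L| * ‖picardIterate F x₀ k s - x s‖ := by gcongr; exact le_abs_self _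
      _ ≤ _ := by
        gcongr
        rw [← dist_eq_norm]
        exact hA s hs.2 k
  calc _ ≤ _ := this
    _ = _ := by ring

/-- Global existence on `[0, ∞)` for `x' = F (t, x)` with `F` measurable in `t` and Lipschitz in
`x`, locally uniformly in `t`. -/
theorem exists_caratheodory_solution [CompleteSpace E]
    (hmeas : ∀ x : ℝ → E, Continuous x →
      AEStronglyMeasurable (fun s => F s (x s)) (volume.restrict (Ici 0)))
    (hlip : ∀ T, ∃ L, ∀ t ∈ Icc 0 T, ∀ x y, ‖F t x - F t y‖ ≤ L * ‖x - y‖)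
    (hbdd : ∀ T, ∃ C, ∀ t ∈ Icc 0 T, ‖F t x₀‖ ≤ C) :
    ∃ x : ℝ → E, Continuous x ∧ x 0 = x₀ ∧ ∀ t, 0 ≤ t →
      IntervalIntegrable (fun s => F s (x s)) volume 0 t ∧
      x t = x₀ + ∫ s in (0 : ℝ)..t, F s (x s) := by
  -- Extension by zero to negative times turns the hypotheses on `[0, T]` into bounds valid for all
  -- `t ≤ T`.
  let G : ℝ → E → E := fun t y => (Ici (0 : ℝ)).indicator (fun s => F s y) t
  have hG : ∀ t, 0 ≤ t → ∀ y, G t y = F t y := fun t ht y => indicator_of_mem (mem_Ici.2 ht) _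
  have hG' : ∀ t, t < 0 → ∀ y, G t y = 0 := fun t ht y =>
    indicator_of_notMem (notMem_Ici.2 ht) _
  obtain ⟨x, hx, hint, heq⟩ := exists_caratheodory_solution_of_eq_zero (F := G) (x₀ := x₀)
    (fun x hx => by
      have h := (aestronglyMeasurable_indicator_iff measurableSet_Ici).2 (hmeas x hx)
      refine h.congr (Eventually.of_forall fun s => ?_)
      simp only [G, indicator])
    (fun T => by
      obtain ⟨L, hL⟩ := hlip T
      refine ⟨max L 0, fun t ht y z => ?_⟩
      rcases lt_or_ge t 0 with h0 | h0
      · rw [hG' t h0, hG' t h0, sub_zero, norm_zero]; positivity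
      · rw [hG t h0, hG t h0]
        exact (hL t ⟨h0, ht⟩ y z).trans (by gcongr; exact le_max_left _ _))
    (fun T => by
      obtain ⟨C, hC⟩ := hbdd T
      refine ⟨max C 0, fun t ht => ?_⟩
      rcases lt_or_ge t 0 with h0 | h0
      · rw [hG' t h0, norm_zero]; positivity
      · rw [hG t h0]; exact (hC t ⟨h0, ht⟩).trans (le_max_left _ _))
    hG'
  refine ⟨x, hx, by simpa using heq 0 le_rfl, fun t ht => ⟨?_, ?_⟩⟩
  · refine (hint t).congr fun s hs => ?_
    rw [uIoc_of_le ht] at hs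
    exact hG s hs.1.le _
  · rw [heq t ht]
    congr 1
    refine intervalIntegral.integral_congr fun s hs => ?_
    rw [uIcc_of_le ht] at hs
    exact hG s hs.1 _

end Caratheodory

/-! ### Hurwitz matrices have bounded exponentials -/

section Hurwitz

/-- A solution of `w' = a w + g` with `Re a < 0` and `g` bounded is bounded on `[0, ∞)`. -/
theorem norm_le_of_hasDerivAt_smul_add {E : Type*} [NormedAddCommGroup E] [NormedSpace ℂ E]
    {w g : ℝ → E} {a : ℂ} (ha : a.re < 0) {G : ℝ}
    (hw : ∀ t, HasDerivAt w (a • w t + g t) t) (hg : ∀ t, 0 ≤ t → ‖g t‖ ≤ G) {t : ℝ} (ht : 0 ≤ t) :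
    ‖w t‖ ≤ ‖w 0‖ + G / (-a.re) := by
  have hG : 0 ≤ G := (norm_nonneg _).trans (hg 0 le_rfl)
  set r := -a.re with hr
  have hrpos : 0 < r := by linarith
  have hnorm : ∀ s : ℝ, ‖Complex.exp (-a * s)‖ = Real.exp (r * s) := fun s => by
    rw [Complex.norm_exp]; simp [hr]
  have hexp : ∀ s : ℝ, HasDerivAt (fun s : ℝ => Complex.exp (-a * s))
      (Complex.exp (-a * s) * (-a * 1)) s := fun s =>
    (((hasDerivAt_id (s : ℂ)).const_mul (-a)).cexp).comp_ofReal
  -- Variation of constants: the factor `exp (-a s)` removes the linear term, and what remains has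
  -- norm at most `G exp (r s)`, the derivative of the boundary function below.
  have hf : ∀ s : ℝ, HasDerivAt (fun s : ℝ => Complex.exp (-a * s) • w s)
      (Complex.exp (-a * s) • g s) s := fun s => by
    refine ((hexp s).smul (hw s)).congr_deriv ?_
    simp only [smul_add, smul_smul, mul_one, mul_neg, neg_smul]
    rw [add_right_comm]
    simp
  have hB : ∀ s : ℝ, HasDerivAt (fun s : ℝ => ‖w 0‖ + G / r * (Real.exp (r * s) - 1))
      (G * Real.exp (r * s)) s := fun s => by
    have he : HasDerivAt (fun s => Real.exp (r * s)) (Real.exp (r * s) * (r * 1)) s :=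
      ((hasDerivAt_id s).const_mul r).exp
    exact (((he.sub_const 1).const_mul (G / r)).const_add _).congr_deriv (by field_simp)
  have hle := image_norm_le_of_norm_deriv_right_le_deriv_boundary (a := 0) (b := t)
    (fun s _ => (hf s).continuousAt.continuousWithinAt) (fun s _ => (hf s).hasDerivWithinAt)
    (by simp) hB (fun s hs => by
      rw [norm_smul, hnorm, mul_comm]
      exact mul_le_mul_of_nonneg_right (hg s hs.1) (Real.exp_pos _).le) (right_mem_Icc.2 ht)
  rw [norm_smul, hnorm] at hle
  have hE := Real.one_le_exp (x := r * t) (by positivity)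
  have hGr : 0 ≤ G / r := by positivity
  have h2 : Real.exp (r * t) * ‖w t‖ ≤ Real.exp (r * t) * (‖w 0‖ + G / r) := by
    have := norm_nonneg (w 0)
    nlinarith
  exact le_of_mul_le_mul_left h2 (Real.exp_pos _)

/-- If a product of factors `k - a` with `Re a < 0` annihilates `B`, then `exp (t k) B` is bounded
on `[0, ∞)`. -/
theorem exists_norm_exp_smul_mul_le {A : Type*} [NormedRing A] [NormedAlgebra ℂ A]
    [CompleteSpace A] (k : A) (l : List ℂ) (hl : ∀ a ∈ l, a.re < 0) (B : A)
    (hB : (l.map fun a => k - algebraMap ℂ A a).prod * B = 0) :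
    ∃ C, ∀ t : ℝ, 0 ≤ t → ‖NormedSpace.exp ((t : ℂ) • k) * B‖ ≤ C := by
  induction l generalizing B with
  | nil =>
    simp only [List.map_nil, List.prod_nil, one_mul] at hB
    exact ⟨0, fun t _ => by simp [hB]⟩
  | cons a l ih =>
    have hcomm : ∀ b ∈ l.map fun a => k - algebraMap ℂ A a, Commute (k - algebraMap ℂ A a) b := by
      intro b hb
      obtain ⟨c, _, rfl⟩ := List.mem_map.1 hb
      exact ((Commute.refl k).sub_right (Algebra.commutes c k).symm).sub_left
        (Algebra.commute_algebraMap_left a _)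
    -- The factors commute, so `k - a` can be absorbed into `B`. Then `w = exp (t k) B` solves `w' =
    -- a w + exp (t k) (k - a) B`, whose forcing term is bounded by induction.
    have hB' : (l.map fun a => k - algebraMap ℂ A a).prod * ((k - algebraMap ℂ A a) * B) = 0 := by
      rw [List.map_cons, List.prod_cons, (Commute.list_prod_right _ _ hcomm).eq] at hB
      rw [← mul_assoc, hB]
    obtain ⟨C, hC⟩ := ih (fun b hb => hl b (List.mem_cons_of_mem _ hb)) _ hB'
    refine ⟨_, fun t ht => norm_le_of_hasDerivAt_smul_add
      (w := fun t : ℝ => NormedSpace.exp ((t : ℂ) • k) * B) (hl a List.mem_cons_self)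
      (fun s => ?_) hC ht⟩
    have h := ((hasDerivAt_exp_smul_const k (s : ℂ)).mul_const B).scomp s
      Complex.ofRealCLM.hasDerivAt
    refine h.congr_deriv ?_
    rw [Complex.ofRealCLM_apply, Complex.ofReal_one, one_smul]
    rw [sub_mul, mul_sub, Algebra.algebraMap_eq_smul_one, smul_mul_assoc, one_mul,
      mul_smul_comm, add_sub_cancel, mul_assoc]

open scoped Matrix.Norms.L2Operator

/-- The exponential of a Hurwitz matrix is bounded on `[0, ∞)`. -/
theorem IsHurwitz.exists_norm_exp_mulVec_le {K : Matrix (Fin 3) (Fin 3) ℝ} (hK : IsHurwitz K) :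
    ∃ C > 0, ∀ t : ℝ, 0 ≤ t → ∀ z : V3,
      ‖(WithLp.toLp 2 (NormedSpace.exp (t • K) *ᵥ z) : Y3)‖ ≤ C * ‖(WithLp.toLp 2 z : Y3)‖ := by
  set k : Matrix (Fin 3) (Fin 3) ℂ := K.map Complex.ofReal with hk
  -- Cayley–Hamilton over `ℂ`: the product of `k - a` over the roots of the characteristic
  -- polynomial vanishes. Neither diagonalization nor a Jordan form is used.
  obtain ⟨C, hC⟩ := exists_norm_exp_smul_mul_le k k.charpoly.roots.toList
    (fun a ha => hK a (Matrix.mem_spectrum_iff_isRoot_charpoly.2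
      (Polynomial.isRoot_of_mem_roots (Multiset.mem_toList.1 ha)))) 1 (by
      have h := Matrix.aeval_self_charpoly k
      rw [(IsAlgClosed.splits k.charpoly).eq_prod_roots_of_monic k.charpoly_monic,
        ← Multiset.coe_toList k.charpoly.roots, Multiset.map_coe, Multiset.prod_coe,
        map_list_prod, List.map_map] at h
      rw [mul_one, ← h]
      congr 1
      refine List.map_congr_left fun a _ => ?_
      simp)
  have hmap : ∀ t : ℝ, (NormedSpace.exp (t • K)).map Complex.ofReal
      = NormedSpace.exp ((t : ℂ) • k) := fun t => by
    have hcont : Continuous (Complex.ofRealHom.mapMatrix :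
        Matrix (Fin 3) (Fin 3) ℝ →+* Matrix (Fin 3) (Fin 3) ℂ) :=
      Continuous.matrix_map continuous_id Complex.continuous_ofReal
    let _ : NormedAlgebra ℚ (Matrix (Fin 3) (Fin 3) ℝ) := NormedAlgebra.restrictScalars ℚ ℝ _
    have h := NormedSpace.map_exp _ hcont (t • K)
    refine h.trans (congrArg _ ?_)
    ext i j
    simp [hk]
  have hnorm : ∀ z : V3, ‖(WithLp.toLp 2 (fun i => (z i : ℂ)) : EuclideanSpace ℂ (Fin 3))‖
      = ‖(WithLp.toLp 2 z : Y3)‖ := fun z => by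
    simp [EuclideanSpace.norm_eq]
  -- The maximum with `1` makes the constant positive, so that a radius can later be divided by it.
  refine ⟨max C 1, lt_max_of_lt_right one_pos, fun t ht z => ?_⟩
  rw [← hnorm, ← hnorm]
  have h := Matrix.l2_opNorm_mulVec (NormedSpace.exp ((t : ℂ) • k))
    (WithLp.toLp 2 (fun i => (z i : ℂ)))
  have hC' := hC t ht
  rw [mul_one] at hC'
  have heq : (fun i => (((NormedSpace.exp (t • K) *ᵥ z) i : ℝ) : ℂ))
      = NormedSpace.exp ((t : ℂ) • k) *ᵥ fun i => (z i : ℂ) := by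
    rw [← hmap]
    ext i
    simp [Matrix.mulVec, dotProduct]
  rw [heq]
  refine le_trans h ?_
  gcongr
  exact hC'.trans (le_max_left _ _)

end Hurwitz

/-! ### Smoothness of the multibody model -/

section Smooth

variable {E : Type*} [NormedAddCommGroup E] [NormedSpace ℝ E] {ι κ μ : Type*}

theorem contDiff_matrix_mul_apply [Fintype κ] {r : WithTop ℕ∞} {A : E → Matrix ι κ ℝ}
    {B : E → Matrix κ μ ℝ} (hA : ∀ i j, ContDiff ℝ r fun x => A x i j)
    (hB : ∀ i j, ContDiff ℝ r fun x => B x i j) (i : ι) (j : μ) :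
    ContDiff ℝ r fun x => (A x * B x) i j := by
  simp only [Matrix.mul_apply]
  exact ContDiff.sum fun k _ => (hA i k).mul (hB k j)

theorem contDiff_mulVec_apply [Fintype κ] {r : WithTop ℕ∞} {A : E → Matrix ι κ ℝ} {v : E → κ → ℝ}
    (hA : ∀ i j, ContDiff ℝ r fun x => A x i j) (hv : ∀ j, ContDiff ℝ r fun x => v x j) (i : ι) :
    ContDiff ℝ r fun x => (A x *ᵥ v x) i := by
  simp only [Matrix.mulVec, dotProduct]
  exact ContDiff.sum fun k _ => (hA i k).mul (hv k)

theorem contDiff_det [Fintype ι] [DecidableEq ι] {r : WithTop ℕ∞} {A : E → Matrix ι ι ℝ}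
    (hA : ∀ i j, ContDiff ℝ r fun x => A x i j) : ContDiff ℝ r fun x => (A x).det := by
  simp only [Matrix.det_apply]
  refine ContDiff.sum fun σ _ => ?_
  exact (contDiff_prod fun i _ => hA _ _).const_smul _

/-- Cramer's rule: each entry is a cofactor, itself a determinant, divided by `det A`. -/
theorem contDiffAt_inv_apply [Fintype ι] [DecidableEq ι] {r : WithTop ℕ∞} {A : E → Matrix ι ι ℝ}
    (hA : ∀ i j, ContDiff ℝ r fun x => A x i j) {x : E} (hx : (A x).det ≠ 0) (i j : ι) :
    ContDiffAt ℝ r (fun x => (A x)⁻¹ i j) x := by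
  simp only [Matrix.inv_def, Matrix.smul_apply, smul_eq_mul, Ring.inverse_eq_inv',
    Matrix.adjugate_apply]
  refine ((contDiff_det hA).contDiffAt.inv hx).mul (contDiff_det fun a b => ?_).contDiffAt
  by_cases h : a = j
  · subst h
    simpa using contDiff_const
  · simpa [Matrix.updateRow_ne h] using hA a b

theorem contDiff_pderiv {n : ℕ} {F : Conf n → ℝ} (hF : ContDiff ℝ ∞ F) (j : Coord n) :
    ContDiff ℝ ∞ (pderiv F j) :=
  (hF.fderiv_right (m := ∞) (by simp)).clm_apply contDiff_const

theorem pderiv_of_forall_add_eq {n : ℕ} {F : Conf n → ℝ} (hF : ContDiff ℝ ∞ F) {j : Coord n} {c : ℝ}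
    {q : Conf n} (h : ∀ t : ℝ, F (q + t • Pi.single j 1) = F q + t * c) : pderiv F j q = c := by
  have h1 := (hF.differentiable (by simp) q).hasFDerivAt.hasLineDerivAt (Pi.single j 1)
  have h2 : HasLineDerivAt ℝ F c q (Pi.single j 1) := by
    unfold HasLineDerivAt
    simp only [h]
    simpa using ((hasDerivAt_id (0 : ℝ)).mul_const c).const_add (F q)
  exact h1.unique h2

/-- The chain rule in coordinates. -/
theorem hasDerivAt_comp_pderiv {n : ℕ} {F : Conf n → ℝ} (hF : ContDiff ℝ ∞ F) {q : ℝ → Conf n}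
    {v : Conf n} {t : ℝ} (hq : HasDerivAt q v t) :
    HasDerivAt (fun s => F (q s)) (∑ k, pderiv F k (q t) * v k) t := by
  have h := (hF.differentiable (by simp) (q t)).hasFDerivAt.comp_hasDerivAt t hq
  refine h.congr_deriv ?_
  conv_lhs => rw [← Finset.univ_sum_single v, map_sum]
  refine Finset.sum_congr rfl fun k _ => ?_
  rw [show (Pi.single k (v k) : Conf n) = v k • Pi.single k 1 by
    rw [← Pi.single_smul, smul_eq_mul, mul_one], map_smul, smul_eq_mul, mul_comm]
  rfl

end Smooth

namespace Robot

variable {n N : ℕ} (rob : Robot n N)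

theorem contDiff_linkPos (i : Fin N) (k : Fin 3) :
    ContDiff ℝ ∞ fun q : Conf n => rob.linkPos i q k := by
  have h := (contDiff_pi.1 (rob.offset_smooth i)) k
  have hl : ContDiff ℝ ∞ fun q : Conf n => fun j => q (Sum.inr j) := by fun_prop
  exact (by fun_prop : ContDiff ℝ ∞ fun q : Conf n => q (Sum.inl k)).add (h.comp hl)

theorem contDiff_linkRot (i : Fin N) (a b : Fin 3) :
    ContDiff ℝ ∞ fun q : Conf n => rob.linkRot i q a b := by
  have hl : ContDiff ℝ ∞ fun q : Conf n => fun j => q (Sum.inr j) := by fun_prop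
  exact (rob.rot_smooth i a b).comp hl

theorem contDiff_linJac (i : Fin N) (k : Fin 3) (j : Coord n) :
    ContDiff ℝ ∞ fun q : Conf n => rob.linJac i q k j :=
  contDiff_pderiv (rob.contDiff_linkPos i k) j

theorem contDiff_angJac (i : Fin N) (k : Fin 3) (j : Coord n) :
    ContDiff ℝ ∞ fun q : Conf n => rob.angJac i q k j := by
  have h : ∀ a b, ContDiff ℝ ∞ fun q : Conf n => ((rob.linkRot i q)ᵀ *
      Matrix.of fun a b => pderiv (fun q' => rob.linkRot i q' a b) j q) a b :=
    contDiff_matrix_mul_apply (fun a b => rob.contDiff_linkRot i b a)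
      (fun a b => contDiff_pderiv (rob.contDiff_linkRot i a b) j)
  fin_cases k
  · exact h 2 1
  · exact h 0 2
  · exact h 1 0

theorem contDiff_massMatrix (a b : Coord n) :
    ContDiff ℝ ∞ fun q : Conf n => rob.massMatrix q a b := by
  simp only [massMatrix, Matrix.sum_apply, Matrix.add_apply, Matrix.smul_apply, smul_eq_mul]
  refine ContDiff.sum fun i _ => (contDiff_const.mul ?_).add ?_
  · exact contDiff_matrix_mul_apply (fun a b => rob.contDiff_linJac i b a)
      (rob.contDiff_linJac i) a b
  · have h : ∀ a b, ContDiff ℝ ∞ fun q : Conf n => ((rob.angJac i q)ᵀ * rob.inertia i) a b :=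
      contDiff_matrix_mul_apply (A := fun q => (rob.angJac i q)ᵀ) (B := fun _ => rob.inertia i)
        (fun a b => rob.contDiff_angJac i b a) fun _ _ => contDiff_const
    exact contDiff_matrix_mul_apply h (rob.contDiff_angJac i) a b

theorem contDiff_coriolis (a b : Coord n) :
    ContDiff ℝ ∞ fun x : Conf n × Conf n => rob.coriolis x.1 x.2 a b := by
  simp only [coriolis, Matrix.of_apply]
  have h : ∀ i j k, ContDiff ℝ ∞ fun x : Conf n × Conf n =>
      pderiv (fun q' => rob.massMatrix q' i j) k x.1 := fun i j k =>
    (contDiff_pderiv (rob.contDiff_massMatrix i j) k).comp contDiff_fst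
  exact ContDiff.sum fun k _ => (contDiff_const.mul (((h _ _ _).add (h _ _ _)).sub (h _ _ _))).mul
    (by fun_prop)

theorem contDiff_com (k : Fin 3) : ContDiff ℝ ∞ fun q : Conf n => rob.com q k := by
  simp only [com, Pi.smul_apply, Finset.sum_apply, smul_eq_mul]
  exact contDiff_const.mul (ContDiff.sum fun i _ => contDiff_const.mul (rob.contDiff_linkPos i k))

theorem contDiff_comJac (k : Fin 3) (j : Coord n) :
    ContDiff ℝ ∞ fun q : Conf n => rob.comJac q k j :=
  contDiff_pderiv (rob.contDiff_com k) j

theorem contDiff_comJacDot (k : Fin 3) (j : Coord n) :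
    ContDiff ℝ ∞ fun x : Conf n × Conf n => rob.comJacDot x.1 x.2 k j := by
  simp only [comJacDot, Matrix.of_apply]
  exact ContDiff.sum fun l _ => ((contDiff_pderiv (rob.contDiff_comJac k j) l).comp
    contDiff_fst).mul (by fun_prop)

/-! ### Base translations -/

/-- The generalized velocities of the base translations. -/
def baseIncl (n : ℕ) : Matrix (Coord n) (Fin 3) ℝ := Matrix.fromRows 1 0

theorem mul_baseIncl_apply {ι : Type*} (A : Matrix ι (Coord n) ℝ) (i : ι) (l : Fin 3) :
    (A * baseIncl n) i l = A i (Sum.inl l) := by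
  simp [baseIncl, Matrix.mul_apply, Matrix.one_apply]

/-- The offset of a link from the base depends only on the remaining coordinates. -/
theorem linJac_mul_baseIncl (i : Fin N) (q : Conf n) : rob.linJac i q * baseIncl n = 1 := by
  ext k l
  rw [mul_baseIncl_apply]
  refine pderiv_of_forall_add_eq (rob.contDiff_linkPos i k) fun t => ?_
  simp only [linkPos, Pi.add_apply]
  simp [Pi.single_apply, Matrix.one_apply]
  ring

/-- Link orientations do not depend on the base position. -/
theorem angJac_mul_baseIncl (i : Fin N) (q : Conf n) : rob.angJac i q * baseIncl n = 0 := by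
  ext k l
  rw [mul_baseIncl_apply]
  have h : (Matrix.of fun a b => pderiv (fun q' => rob.linkRot i q' a b) (Sum.inl l) q) = 0 := by
    ext a b
    refine pderiv_of_forall_add_eq (rob.contDiff_linkRot i a b) fun t => ?_
    have hs : (fun j => (q + t • Pi.single (Sum.inl l) (1 : ℝ) : Conf n) (Sum.inr j))
        = fun j => q (Sum.inr j) := by ext j; simp
    simp only [linkRot, hs]
    simp
  simp only [angJac, Matrix.of_apply, h, mul_zero]
  fin_cases k <;> simp [vee]

theorem totalMass_smul_comJac (hm : rob.totalMass ≠ 0) (q : Conf n) :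
    rob.totalMass • rob.comJac q = ∑ i, rob.mass i • rob.linJac i q := by
  ext k j
  simp only [Matrix.smul_apply, Matrix.sum_apply, smul_eq_mul, comJac, linJac, Matrix.of_apply]
  have hd : ∀ i, DifferentiableAt ℝ (fun q' => rob.linkPos i q' k) q := fun i =>
    (rob.contDiff_linkPos i k).differentiable (by simp) q
  have : (fun q' => rob.com q' k)
      = fun q' => (1 / rob.totalMass) * ∑ i, rob.mass i * rob.linkPos i q' k := by
    ext q'
    simp [com, Finset.sum_apply]
  rw [this, pderiv, fderiv_const_mul (DifferentiableAt.fun_sum fun i _ => (hd i).const_mul _),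
    fderiv_fun_sum fun i _ => (hd i).const_mul _]
  simp only [_root_.smul_apply, _root_.sum_apply, smul_eq_mul]
  rw [← mul_assoc, mul_one_div_cancel hm, one_mul]
  refine Finset.sum_congr rfl fun i _ => ?_
  rw [fderiv_const_mul (hd i)]
  rfl

theorem comJac_mul_baseIncl (hm : rob.totalMass ≠ 0) (q : Conf n) :
    rob.comJac q * baseIncl n = 1 := by
  have h : rob.totalMass • (rob.comJac q * baseIncl n) = rob.totalMass • 1 := by
    rw [← Matrix.smul_mul, rob.totalMass_smul_comJac hm, Matrix.sum_mul]
    simp only [Matrix.smul_mul, linJac_mul_baseIncl, ← Finset.sum_smul, totalMass]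
  exact smul_right_injective _ hm h

/-- The pivotal identity. Rotational terms vanish on translations and `Jᵢ E = 1`, so `M E = ∑ mᵢ
Jᵢᵀ`. Transposed, it says that the total linear momentum is `m` times the velocity of the center of
mass. -/
theorem massMatrix_mul_baseIncl (hm : rob.totalMass ≠ 0) (q : Conf n) :
    rob.massMatrix q * baseIncl n = rob.totalMass • (rob.comJac q)ᵀ := by
  rw [← Matrix.transpose_smul, rob.totalMass_smul_comJac hm, massMatrix, Matrix.sum_mul,
    Matrix.transpose_sum]
  refine Finset.sum_congr rfl fun i _ => ?_
  rw [Matrix.add_mul, Matrix.smul_mul, Matrix.mul_assoc, linJac_mul_baseIncl, Matrix.mul_one,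
    Matrix.mul_assoc, angJac_mul_baseIncl, Matrix.mul_zero, add_zero, Matrix.transpose_smul]

theorem massMatrix_isSymm (q : Conf n) : (rob.massMatrix q)ᵀ = rob.massMatrix q := by
  simp only [massMatrix, Matrix.transpose_sum, Matrix.transpose_add, Matrix.transpose_smul,
    Matrix.transpose_mul, Matrix.transpose_transpose]
  refine Finset.sum_congr rfl fun i _ => ?_
  have h : (rob.inertia i)ᵀ = rob.inertia i := by
    simpa using (rob.inertia_posSemidef i).isHermitian.eq
  rw [h, Matrix.mul_assoc _ (rob.inertia i)]

/-- Positive definiteness excludes a robot without links, whose mass matrix is zero. -/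
theorem totalMass_pos {q : Conf n} (hM : (rob.massMatrix q).PosDef) : 0 < rob.totalMass := by
  have hne : Nonempty (Fin N) := by
    by_contra h
    rw [not_nonempty_iff] at h
    have h0 : rob.massMatrix q = 0 := by simp [massMatrix]
    have := hM.diag_pos (i := Sum.inl 0)
    simp [h0] at this
  exact Finset.sum_pos (fun i _ => rob.mass_pos i) Finset.univ_nonempty

variable {rob} {q : Conf n}

theorem inv_massMatrix_mul_comJac_transpose (hM : (rob.massMatrix q).PosDef) :
    (rob.massMatrix q)⁻¹ * (rob.comJac q)ᵀ = rob.totalMass⁻¹ • baseIncl n := by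
  have hm := (rob.totalMass_pos hM).ne'
  have hdet := (Matrix.isUnit_iff_isUnit_det _).1 hM.isUnit
  have h := congrArg ((rob.massMatrix q)⁻¹ * ·) (rob.massMatrix_mul_baseIncl hm q)
  simp only [Matrix.nonsing_inv_mul_cancel_left _ _ hdet, Matrix.mul_smul] at h
  rw [h, smul_smul, inv_mul_cancel₀ hm, one_smul]

/-- The task-space inertia of the center of mass is the total mass. -/
theorem taskInertia_eq (hM : (rob.massMatrix q).PosDef) :
    rob.taskInertia q = rob.totalMass • 1 := by
  have hm := (rob.totalMass_pos hM).ne'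
  rw [taskInertia, Matrix.mul_assoc, inv_massMatrix_mul_comJac_transpose hM, Matrix.mul_smul,
    rob.comJac_mul_baseIncl hm]
  refine Matrix.inv_eq_left_inv ?_
  rw [Matrix.smul_mul, Matrix.mul_smul, one_mul, smul_smul, mul_inv_cancel₀ hm, one_smul]

theorem inv_massMatrix_mul_comJac_transpose_mul_taskInertia (hM : (rob.massMatrix q).PosDef) :
    (rob.massMatrix q)⁻¹ * (rob.comJac q)ᵀ * rob.taskInertia q = baseIncl n := by
  have hm := (rob.totalMass_pos hM).ne'
  rw [inv_massMatrix_mul_comJac_transpose hM, taskInertia_eq hM, Matrix.mul_smul, Matrix.mul_one,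
    smul_smul, mul_inv_cancel₀ hm, one_smul]

end Robot

/-! ### Product rules for matrix-vector and dot products -/

section MatrixCalculus

variable {ι κ : Type*} [Fintype κ]

theorem HasDerivAt.mulVec' [Finite ι] {A : ℝ → Matrix ι κ ℝ} {A' : Matrix ι κ ℝ} {v : ℝ → κ → ℝ}
    {v' : κ → ℝ} {t : ℝ} (hA : ∀ i j, HasDerivAt (fun s => A s i j) (A' i j) t)
    (hv : HasDerivAt v v' t) :
    HasDerivAt (fun s => A s *ᵥ v s) (A' *ᵥ v t + A t *ᵥ v') t := by
  rw [hasDerivAt_pi] at hv ⊢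
  intro i
  simp only [Matrix.mulVec, dotProduct, Pi.add_apply, ← Finset.sum_add_distrib]
  exact HasDerivAt.fun_sum fun j _ => (hA i j).mul (hv j)

theorem HasDerivAt.dotProduct' [Fintype ι] {v w : ℝ → ι → ℝ} {v' w' : ι → ℝ} {t : ℝ}
    (hv : HasDerivAt v v' t) (hw : HasDerivAt w w' t) :
    HasDerivAt (fun s => v s ⬝ᵥ w s) (v' ⬝ᵥ w t + v t ⬝ᵥ w') t := by
  rw [hasDerivAt_pi] at hv hw
  simp only [dotProduct, ← Finset.sum_add_distrib]
  exact HasDerivAt.fun_sum fun j _ => (hv j).mul (hw j)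

end MatrixCalculus

/-! ### The Lyapunov-like function -/

section Lyapunov

variable {n N : ℕ} (rob : Robot n N)

/-- The quadratic form of `lyapMatrix`, with the task-space inertia replaced by the total mass. -/
def lyapQuad (κ α : ℝ) (q v : Conf n) (e : V3) : ℝ :=
  1 / (2 * κ) * (v ⬝ᵥ rob.massMatrix q *ᵥ v)
    + α * rob.totalMass * ((rob.comJac q *ᵥ v) ⬝ᵥ e) + e ⬝ᵥ e

/-- The residual terms, with the task-space inertia replaced by the total mass. -/
def otherQuad (κ α : ℝ) (KD : Matrix (Coord n) (Coord n) ℝ) (x₁ : Conf n × Conf n)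
    (e u : V3) (τ : Conf n) : ℝ :=
  -2 * (u ⬝ᵥ e) + α * rob.totalMass * ((rob.comJacDot x₁.1 x₁.2 *ᵥ x₁.2) ⬝ᵥ e)
    + α * (((Robot.baseIncl n)ᵀ *ᵥ (KD *ᵥ ((rob.comJac x₁.1)ᵀ *ᵥ u - x₁.2))) ⬝ᵥ e)
    + α * (((Robot.baseIncl n)ᵀ *ᵥ (τ - rob.coriolis x₁.1 x₁.2 *ᵥ x₁.2)) ⬝ᵥ e)
    + 2 * α ^ 2 * κ * rob.totalMass * ((rob.comJac x₁.1 *ᵥ x₁.2) ⬝ᵥ e)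
    + 1 / κ * ((rob.comJac x₁.1 *ᵥ (KD *ᵥ x₁.2)) ⬝ᵥ u)
    - α * rob.totalMass * ((rob.comJac x₁.1 *ᵥ x₁.2) ⬝ᵥ u) + 1 / κ * (x₁.2 ⬝ᵥ τ)

variable {rob} {κ α : ℝ} {KD : Matrix (Coord n) (Coord n) ℝ}

theorem lyapMatrix_eq {q : Conf n} (hM : (rob.massMatrix q).PosDef) :
    lyapMatrix rob κ α q = Matrix.fromBlocks ((1 / (2 * κ)) • rob.massMatrix q)
      ((α / 2 * rob.totalMass) • (rob.comJac q)ᵀ) ((α / 2 * rob.totalMass) • rob.comJac q) 1 := by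
  rw [lyapMatrix, Robot.taskInertia_eq hM]
  simp only [Matrix.mul_smul, Matrix.mul_one, Matrix.smul_mul, Matrix.one_mul, smul_smul]

theorem dotProduct_lyapMatrix_mulVec {q : Conf n} (hM : (rob.massMatrix q).PosDef) (v : Conf n)
    (e : V3) : Sum.elim v e ⬝ᵥ lyapMatrix rob κ α q *ᵥ Sum.elim v e = lyapQuad rob κ α q v e := by
  rw [lyapMatrix_eq hM, Matrix.fromBlocks_mulVec, sumElim_dotProduct_sumElim]
  simp only [Sum.elim_comp_inl, Sum.elim_comp_inr, Matrix.smul_mulVec, dotProduct_add,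
    dotProduct_smul, smul_eq_mul, Matrix.one_mulVec, lyapQuad, Matrix.mulVec_transpose]
  rw [dotProduct_comm v (e ᵥ* rob.comJac q), ← Matrix.dotProduct_mulVec,
    dotProduct_comm e (rob.comJac q *ᵥ v)]
  ring

theorem lyapFn_eq {x₁ : Conf n × Conf n} (hM : (rob.massMatrix x₁.1).PosDef) (x₂ : V3) :
    lyapFn rob κ α x₁ x₂ = lyapQuad rob κ α x₁.1 x₁.2 (rob.com x₁.1 - x₂) :=
  dotProduct_lyapMatrix_mulVec hM _ _

/-- Every inverse of `M` occurs inside `M⁻¹ Jᵀ Λ`, which equals `E`. The symmetry of `K_D` lets the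
row vectors of the definition be rewritten as column vectors. -/
theorem otherTerms_eq (hKD : KDᵀ = KD) {x₁ : Conf n × Conf n}
    (hM : (rob.massMatrix x₁.1).PosDef) (x₂ u : V3) (τ : Conf n) :
    otherTerms rob κ α KD x₁ x₂ u τ = otherQuad rob κ α KD x₁ (rob.com x₁.1 - x₂) u τ := by
  have h1 : KD * (rob.massMatrix x₁.1)⁻¹ * (rob.comJac x₁.1)ᵀ * rob.taskInertia x₁.1
      = (((Robot.baseIncl n)ᵀ) * KD)ᵀ := by
    rw [Matrix.mul_assoc KD, Matrix.mul_assoc KD,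
      Robot.inv_massMatrix_mul_comJac_transpose_mul_taskInertia hM, Matrix.transpose_mul, hKD,
      Matrix.transpose_transpose]
  have h2 : KD * (rob.comJac x₁.1)ᵀ = (rob.comJac x₁.1 * KD)ᵀ := by
    rw [Matrix.transpose_mul, hKD]
  simp only [otherTerms, h1, h2,
    Robot.inv_massMatrix_mul_comJac_transpose_mul_taskInertia hM]
  simp only [Robot.taskInertia_eq hM, Matrix.mul_smul, Matrix.mul_one, Matrix.vecMul_smul,
    Matrix.vecMul_transpose]
  simp only [← Matrix.mulVec_transpose, ← Matrix.mulVec_mulVec, add_dotProduct,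
    smul_dotProduct, sub_dotProduct, smul_eq_mul, otherQuad]
  ring

/-- The passivity identity `vᵀ (M' - 2 C) v = 0`. Contracted with `v` three times, the three
Christoffel sums are equal up to renaming indices, so the last two cancel. -/
theorem dotProduct_coriolis_mulVec (q v : Conf n) :
    v ⬝ᵥ rob.coriolis q v *ᵥ v = 1 / 2 * (v ⬝ᵥ (Matrix.of fun i j =>
      ∑ k, pderiv (fun q' => rob.massMatrix q' i j) k q * v k) *ᵥ v) := by
  set D : Coord n → Coord n → Coord n → ℝ := fun i j k =>
    pderiv (fun q' => rob.massMatrix q' i j) k q with hD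
  have e1 : v ⬝ᵥ rob.coriolis q v *ᵥ v
      = 1 / 2 * ((∑ i, ∑ j, ∑ k, D i j k * v i * v j * v k)
        + (∑ i, ∑ j, ∑ k, D i k j * v i * v j * v k)
        - ∑ i, ∑ j, ∑ k, D j k i * v i * v j * v k) := by
    simp only [Robot.coriolis, Matrix.mulVec, dotProduct, Matrix.of_apply, ← Finset.sum_add_distrib,
      ← Finset.sum_sub_distrib, Finset.mul_sum, Finset.sum_mul]
    refine Finset.sum_congr rfl fun i _ => Finset.sum_congr rfl fun j _ =>
      Finset.sum_congr rfl fun k _ => ?_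
    simp only [hD]
    ring
  have e2 : ∑ i, ∑ j, ∑ k, D i k j * v i * v j * v k
      = ∑ i, ∑ j, ∑ k, D i j k * v i * v j * v k := by
    refine Finset.sum_congr rfl fun i _ => ?_
    rw [Finset.sum_comm]
    exact Finset.sum_congr rfl fun j _ => Finset.sum_congr rfl fun k _ => by ring
  have e3 : ∑ i, ∑ j, ∑ k, D j k i * v i * v j * v k
      = ∑ i, ∑ j, ∑ k, D i j k * v i * v j * v k := by
    rw [Finset.sum_comm]
    refine Finset.sum_congr rfl fun i _ => ?_
    rw [Finset.sum_comm]
    exact Finset.sum_congr rfl fun j _ => Finset.sum_congr rfl fun k _ => by ring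
  rw [e1, e2, e3]
  simp only [Matrix.mulVec, dotProduct, Matrix.of_apply, Finset.mul_sum, Finset.sum_mul,
    add_sub_cancel_right]
  refine Finset.sum_congr rfl fun i _ => Finset.sum_congr rfl fun j _ =>
      Finset.sum_congr rfl fun k _ => ?_
  simp only [hD]
  ring

theorem hasDerivAt_com {q : ℝ → Conf n} {v : Conf n} {t : ℝ} (hq : HasDerivAt q v t) :
    HasDerivAt (fun s => rob.com (q s)) (rob.comJac (q t) *ᵥ v) t :=
  hasDerivAt_pi.2 fun k => hasDerivAt_comp_pderiv (rob.contDiff_com k) hq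

/-- The derivative of the Lyapunov-like function along a curve with acceleration `a`. -/
theorem hasDerivAt_lyapQuad {q v : ℝ → Conf n} {x₂ : ℝ → V3} {a : Conf n} {u : V3} {t : ℝ}
    (hq : HasDerivAt q (v t) t) (hv : HasDerivAt v a t) (hx₂ : HasDerivAt x₂ u t) :
    HasDerivAt (fun s => lyapQuad rob κ α (q s) (v s) (rob.com (q s) - x₂ s))
      (1 / κ * (v t ⬝ᵥ (rob.massMatrix (q t) *ᵥ a + rob.coriolis (q t) (v t) *ᵥ v t))
        + α * rob.totalMass *
          ((rob.comJacDot (q t) (v t) *ᵥ v t + rob.comJac (q t) *ᵥ a) ⬝ᵥ (rob.com (q t) - x₂ t)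
            + (rob.comJac (q t) *ᵥ v t) ⬝ᵥ (rob.comJac (q t) *ᵥ v t - u))
        + 2 * ((rob.com (q t) - x₂ t) ⬝ᵥ (rob.comJac (q t) *ᵥ v t - u))) t := by
  have he := (hasDerivAt_com (rob := rob) hq).sub hx₂
  have hM := hv.dotProduct' (HasDerivAt.mulVec' (A := fun s => rob.massMatrix (q s))
    (A' := Matrix.of fun i j => ∑ k, pderiv (fun q' => rob.massMatrix q' i j) k (q t) * v t k)
    (fun i j => hasDerivAt_comp_pderiv (rob.contDiff_massMatrix i j) hq) hv)
  have hJ := HasDerivAt.mulVec' (A := fun s => rob.comJac (q s)) (A' := rob.comJacDot (q t) (v t))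
    (fun i j => hasDerivAt_comp_pderiv (rob.contDiff_comJac i j) hq) hv
  refine (((hM.const_mul (1 / (2 * κ))).add ((hJ.dotProduct' he).const_mul
    (α * rob.totalMass))).add (he.dotProduct' he)).congr_deriv ?_
  have hsymm : a ⬝ᵥ rob.massMatrix (q t) *ᵥ v t = v t ⬝ᵥ rob.massMatrix (q t) *ᵥ a := by
    rw [Matrix.dotProduct_mulVec, ← Matrix.mulVec_transpose, rob.massMatrix_isSymm,
      dotProduct_comm]
  have hcor := dotProduct_coriolis_mulVec (rob := rob) (q t) (v t)
  simp only [dotProduct_add, hsymm, hcor, Pi.sub_apply]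
  rw [dotProduct_comm (rob.comJac (q t) *ᵥ v t - u) (rob.com (q t) - x₂ t)]
  ring

/-- The Lyapunov-like estimate `𝒱' ≤ - 2 α κ 𝒱 + OT` along the closed loop. -/
theorem deriv_lyapQuad_le {q v a d : Conf n} {e u : V3} (hκ : 0 < κ) (hKD : KDᵀ = KD)
    (hM : (rob.massMatrix q).PosDef)
    (hαM : ((1 / κ) • KD - α • ((rob.comJac q)ᵀ * rob.taskInertia q * rob.comJac q)
      - α • rob.massMatrix q).PosSemidef)
    (ha : rob.massMatrix q *ᵥ a = -((2 * κ) • ((rob.comJac q)ᵀ *ᵥ e))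
      - KD *ᵥ (v - (rob.comJac q)ᵀ *ᵥ u) + d - rob.coriolis q v *ᵥ v) :
    1 / κ * (v ⬝ᵥ (rob.massMatrix q *ᵥ a + rob.coriolis q v *ᵥ v))
        + α * rob.totalMass * ((rob.comJacDot q v *ᵥ v + rob.comJac q *ᵥ a) ⬝ᵥ e
            + (rob.comJac q *ᵥ v) ⬝ᵥ (rob.comJac q *ᵥ v - u))
        + 2 * (e ⬝ᵥ (rob.comJac q *ᵥ v - u))
      ≤ -(2 * α * κ) * lyapQuad rob κ α q v e + otherQuad rob κ α KD (q, v) e u d := by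
  have hm := (rob.totalMass_pos hM).ne'
  set J := rob.comJac q
  set m := rob.totalMass
  have hEJ : ∀ w : V3, (Robot.baseIncl n)ᵀ *ᵥ (Jᵀ *ᵥ w) = w := fun w => by
    rw [Matrix.mulVec_mulVec, ← Matrix.transpose_mul, rob.comJac_mul_baseIncl hm,
      Matrix.transpose_one, Matrix.one_mulVec]
  -- Since `m J = Eᵀ M`, the acceleration of the center of mass is read off from the equation of
  -- motion without inverting `M`.
  have hJa : m * ((J *ᵥ a) ⬝ᵥ e) = ((Robot.baseIncl n)ᵀ *ᵥ (rob.massMatrix q *ᵥ a)) ⬝ᵥ e := by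
    rw [Matrix.mulVec_mulVec, ← rob.massMatrix_isSymm q, ← Matrix.transpose_mul,
      rob.massMatrix_mul_baseIncl hm, Matrix.transpose_smul, Matrix.transpose_transpose,
      Matrix.smul_mulVec, smul_dotProduct, smul_eq_mul]
  have hvJ : ∀ w : V3, v ⬝ᵥ Jᵀ *ᵥ w = (J *ᵥ v) ⬝ᵥ w := fun w => by
    rw [Matrix.dotProduct_mulVec, Matrix.vecMul_transpose]
  have hvKJ : v ⬝ᵥ KD *ᵥ (Jᵀ *ᵥ u) = (J *ᵥ (KD *ᵥ v)) ⬝ᵥ u := by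
    rw [Matrix.dotProduct_mulVec, ← Matrix.mulVec_transpose, hKD, Matrix.dotProduct_mulVec,
      Matrix.vecMul_transpose]
  have hpsd := hαM.dotProduct_mulVec_nonneg v
  rw [Robot.taskInertia_eq hM] at hpsd
  simp only [star_trivial, Matrix.mul_smul, Matrix.mul_one, Matrix.smul_mul, Matrix.sub_mulVec,
    Matrix.smul_mulVec, dotProduct_sub, dotProduct_smul, smul_eq_mul, ← Matrix.mulVec_mulVec,
    hvJ] at hpsd
  have hJa' := hJa
  rw [ha] at hJa'
  simp only [Matrix.mulVec_add, Matrix.mulVec_sub, Matrix.mulVec_neg, Matrix.mulVec_smul, hEJ,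
    add_dotProduct, sub_dotProduct, neg_dotProduct, smul_dotProduct, smul_eq_mul] at hJa'
  rw [ha]
  simp only [lyapQuad, otherQuad, Matrix.mulVec_sub, hvJ, hvKJ, add_dotProduct, sub_dotProduct,
    dotProduct_add, dotProduct_sub, dotProduct_neg, dotProduct_smul, smul_eq_mul]
  rw [dotProduct_comm e (J *ᵥ v), dotProduct_comm e u]
  set jv := J *ᵥ v
  have hk : 1 / κ * κ = 1 := by field_simp
  have hk2 : 1 / (2 * κ) * κ = 1 / 2 := by field_simp
  generalize 1 / (2 * κ) = c at *
  generalize 1 / κ = b at *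
  generalize (J *ᵥ a) ⬝ᵥ e = p at *
  generalize jv ⬝ᵥ e = p1 at *
  generalize jv ⬝ᵥ jv = p2 at *
  generalize v ⬝ᵥ rob.massMatrix q *ᵥ v = p3 at *
  generalize v ⬝ᵥ KD *ᵥ v = p4 at *
  rw [show α * m * ((rob.comJacDot q v *ᵥ v) ⬝ᵥ e + p + (p2 - jv ⬝ᵥ u))
    = α * m * ((rob.comJacDot q v *ᵥ v) ⬝ᵥ e + (p2 - jv ⬝ᵥ u)) + α * (m * p) by ring, hJa']
  -- The slack in the estimate equals the form in `hpsd`. The spring force `-2 κ Jᵀ e` cancels `2 eᵀ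
  -- J v` in the energy part, and through `α m (J a)ᵀ e` it produces the damping `-2 α κ eᵀ e`.
  refine sub_nonneg.1 (hpsd.trans (le_of_eq ?_))
  linear_combination (-2 * p1) * hk + 2 * α * p3 * hk2

end Lyapunov

/-! ### Positivity of `P`, finiteness of the residual, and invariance of the sublevel set -/

section Bounds

variable {n N : ℕ} {rob : Robot n N} {κ α : ℝ} {KD : Matrix (Coord n) (Coord n) ℝ}

theorem contDiff_dotProduct {E ι : Type*} [NormedAddCommGroup E] [NormedSpace ℝ E] [Fintype ι]
    {r : WithTop ℕ∞} {v w : E → ι → ℝ} (hv : ∀ i, ContDiff ℝ r fun x => v x i)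
    (hw : ∀ i, ContDiff ℝ r fun x => w x i) : ContDiff ℝ r fun x => v x ⬝ᵥ w x := by
  simp only [dotProduct]
  exact ContDiff.sum fun i _ => (hv i).mul (hw i)

theorem contDiff_lyapQuad : ContDiff ℝ ∞ fun x : (Conf n × Conf n) × V3 =>
    lyapQuad rob κ α x.1.1 x.1.2 x.2 := by
  have hq : ContDiff ℝ ∞ fun x : (Conf n × Conf n) × V3 => x.1.1 := by fun_prop
  have hv : ∀ i, ContDiff ℝ ∞ fun x : (Conf n × Conf n) × V3 => x.1.2 i := fun i => by fun_prop
  have he : ∀ i, ContDiff ℝ ∞ fun x : (Conf n × Conf n) × V3 => x.2 i := fun i => by fun_prop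
  have hM := contDiff_mulVec_apply (A := fun x : (Conf n × Conf n) × V3 => rob.massMatrix x.1.1)
    (fun i j => (rob.contDiff_massMatrix i j).comp hq) hv
  have hJ := contDiff_mulVec_apply (A := fun x : (Conf n × Conf n) × V3 => rob.comJac x.1.1)
    (fun i j => (rob.contDiff_comJac i j).comp hq) hv
  exact ((contDiff_const.mul (contDiff_dotProduct hv hM)).add
    (contDiff_const.mul (contDiff_dotProduct hJ he))).add (contDiff_dotProduct he he)

/-- Let `s = J v` be the velocity of the center of mass and `y = v - E s`, so that `J y = 0`. As in
König's theorem, `vᵀ M v = yᵀ M y + m sᵀ s`. The cross term `α m sᵀ e` is absorbed by completing the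
square in `e`, at a cost in `sᵀ s` that the bound on `α` keeps strictly below `m / (2 κ)`. -/
theorem lyapQuad_pos (hκ : 0 < κ) (hα : 0 < α) (hα' : α < 1 / √(κ * rob.totalMass / 2))
    {q : Conf n} (hM : (rob.massMatrix q).PosDef) {v : Conf n} {e : V3} (hne : v ≠ 0 ∨ e ≠ 0) :
    0 < lyapQuad rob κ α q v e := by
  have hm := rob.totalMass_pos hM
  set J := rob.comJac q
  set m := rob.totalMass
  set s := J *ᵥ v with hs
  set y := v - Robot.baseIncl n *ᵥ s with hy
  have hα2 : α ^ 2 * (κ * m / 2) < 1 := by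
    have hpos : 0 < κ * m / 2 := by positivity
    rw [lt_div_iff₀ (Real.sqrt_pos.2 hpos)] at hα'
    calc α ^ 2 * (κ * m / 2) = (α * √(κ * m / 2)) ^ 2 := by
          rw [mul_pow, Real.sq_sqrt hpos.le]
      _ < 1 := by
          rw [sq_lt_one_iff₀ (by positivity)]
          exact hα'
  have hME : ∀ w : V3, rob.massMatrix q *ᵥ (Robot.baseIncl n *ᵥ w) = m • Jᵀ *ᵥ w := fun w => by
    rw [Matrix.mulVec_mulVec, rob.massMatrix_mul_baseIncl hm.ne', Matrix.smul_mulVec]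
  have hEM : ∀ a b : Conf n, a ⬝ᵥ rob.massMatrix q *ᵥ b = b ⬝ᵥ rob.massMatrix q *ᵥ a := fun a b => by
    rw [Matrix.dotProduct_mulVec, ← Matrix.mulVec_transpose, rob.massMatrix_isSymm,
      dotProduct_comm]
  have hJt : ∀ (a : Conf n) (w : V3), a ⬝ᵥ Jᵀ *ᵥ w = (J *ᵥ a) ⬝ᵥ w := fun a w => by
    rw [Matrix.dotProduct_mulVec, Matrix.vecMul_transpose]
  have hJE : J *ᵥ (Robot.baseIncl n *ᵥ s) = s := by
    rw [Matrix.mulVec_mulVec, rob.comJac_mul_baseIncl hm.ne', Matrix.one_mulVec]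
  have hyy : y ⬝ᵥ rob.massMatrix q *ᵥ y = v ⬝ᵥ rob.massMatrix q *ᵥ v - m * (s ⬝ᵥ s) := by
    simp only [hy, Matrix.mulVec_sub, sub_dotProduct, dotProduct_sub]
    rw [hEM (Robot.baseIncl n *ᵥ s) v]
    simp only [hME, dotProduct_smul, hJt, hJE, smul_eq_mul, ← hs]
    ring
  have hform : lyapQuad rob κ α q v e = 1 / (2 * κ) * (y ⬝ᵥ rob.massMatrix q *ᵥ y)
      + (m / (2 * κ) * (1 - α ^ 2 * (κ * m / 2)) * (s ⬝ᵥ s)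
        + (e + (α * m / 2) • s) ⬝ᵥ (e + (α * m / 2) • s)) := by
    rw [hyy]
    simp only [lyapQuad, add_dotProduct, dotProduct_add, smul_dotProduct, dotProduct_smul,
      smul_eq_mul]
    rw [dotProduct_comm e s]
    change 1 / (2 * κ) * (v ⬝ᵥ rob.massMatrix q *ᵥ v) + α * m * (s ⬝ᵥ e) + e ⬝ᵥ e = _
    field_simp
    ring
  have h1 : 0 ≤ y ⬝ᵥ rob.massMatrix q *ᵥ y := hM.posSemidef.dotProduct_mulVec_nonneg y
  have h2 : 0 ≤ s ⬝ᵥ s := by simpa using dotProduct_star_self_nonneg s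
  have h3 : 0 ≤ (e + (α * m / 2) • s) ⬝ᵥ (e + (α * m / 2) • s) := by
    simpa using dotProduct_star_self_nonneg (e + (α * m / 2) • s)
  have hc : 0 < m / (2 * κ) * (1 - α ^ 2 * (κ * m / 2)) :=
    mul_pos (by positivity) (by linarith)
  rw [hform]
  by_contra! hle
  have hc2 : 0 < 1 / (2 * κ) := by positivity
  have t1 := mul_nonneg hc2.le h1
  have t2 := mul_nonneg hc.le h2
  have hs0 : s = 0 := by
    refine dotProduct_self_eq_zero.1 ?_
    have : m / (2 * κ) * (1 - α ^ 2 * (κ * m / 2)) * (s ⬝ᵥ s) = 0 := by linarith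
    exact (mul_eq_zero.1 this).resolve_left hc.ne'
  have he0 : e = 0 := by
    have : (e + (α * m / 2) • s) ⬝ᵥ (e + (α * m / 2) • s) = 0 := by linarith
    simpa [hs0] using this
  have hy0 : y = 0 := by
    by_contra hne
    have := hM.dotProduct_mulVec_pos hne
    rw [star_trivial] at this
    have := mul_pos hc2 this
    linarith
  have hv0 : v = 0 := by simpa [hy, hs0] using hy0
  exact hne.elim (· hv0) (· he0)

theorem lyapMatrix_isHermitian {q : Conf n} (hM : (rob.massMatrix q).PosDef) :
    (lyapMatrix rob κ α q).IsHermitian := by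
  rw [lyapMatrix_eq hM]
  refine Matrix.IsHermitian.fromBlocks ?_ ?_ Matrix.isHermitian_one
  · rw [Matrix.IsHermitian, Matrix.conjTranspose_eq_transpose_of_trivial, Matrix.transpose_smul,
      rob.massMatrix_isSymm]
  · rw [Matrix.conjTranspose_eq_transpose_of_trivial, Matrix.transpose_smul,
      Matrix.transpose_transpose]

/-- The norm of `ι → ℝ` is the sup norm, so the Euclidean sphere has to be described by the dot
product. -/
theorem isCompact_setOf_dotProduct_self_eq_one {ι : Type*} [Fintype ι] :
    IsCompact {w : ι → ℝ | w ⬝ᵥ w = 1} := by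
  refine Metric.isCompact_of_isClosed_isBounded
    (isClosed_eq (by simp only [dotProduct]; fun_prop) continuous_const) ?_
  refine (Metric.isBounded_closedBall (x := (0 : ι → ℝ)) (r := 1)).subset fun w hw => ?_
  rw [mem_closedBall_zero_iff, pi_norm_le_iff_of_nonneg zero_le_one]
  intro i
  rw [Real.norm_eq_abs, ← sq_le_one_iff_abs_le_one, ← (show w ⬝ᵥ w = 1 from hw), sq]
  exact Finset.single_le_sum (f := fun i => w i * w i) (fun i _ => mul_self_nonneg (w i))
    (Finset.mem_univ i)

/-- The minimal eigenvalue of `P` over a compact set of states exists and is positive. -/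
theorem exists_isLeast_eigenvalue_lyapMatrix {X₁ : Set (Conf n × Conf n)} (hX₁ : IsCompact X₁)
    (hX₁ne : X₁.Nonempty) (hM : ∀ x ∈ X₁, (rob.massMatrix x.1).PosDef) (hκ : 0 < κ) (hα : 0 < α)
    (hα' : α < 1 / √(κ * rob.totalMass / 2)) :
    ∃ β, 0 < β ∧ IsLeast {b | ∃ x ∈ X₁,
        Module.End.HasEigenvalue (Matrix.toLin' (lyapMatrix rob κ α x.1)) b} β ∧
      ∀ x ∈ X₁, ∀ w, β * (w ⬝ᵥ w) ≤ w ⬝ᵥ lyapMatrix rob κ α x.1 *ᵥ w := by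
  have hquad : ∀ x ∈ X₁, ∀ w, w ⬝ᵥ lyapMatrix rob κ α x.1 *ᵥ w
      = lyapQuad rob κ α x.1 (w ∘ Sum.inl) (w ∘ Sum.inr) := fun x hx w => by
    rw [← dotProduct_lyapMatrix_mulVec (hM x hx), Sum.elim_comp_inl_inr]
  have hcont : Continuous fun z : (Conf n × Conf n) × (Coord n ⊕ Fin 3 → ℝ) =>
      lyapQuad rob κ α z.1.1 (z.2 ∘ Sum.inl) (z.2 ∘ Sum.inr) := by
    have h : Continuous fun z : (Conf n × Conf n) × (Coord n ⊕ Fin 3 → ℝ) =>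
        (((z.1.1, fun i => z.2 (Sum.inl i)), fun i => z.2 (Sum.inr i)) :
          (Conf n × Conf n) × V3) := by fun_prop
    exact (contDiff_lyapQuad (rob := rob) (κ := κ) (α := α)).continuous.comp h
  have hsne : {w : Coord n ⊕ Fin 3 → ℝ | w ⬝ᵥ w = 1}.Nonempty :=
    ⟨Pi.single (Sum.inr 0) 1, by simp⟩
  -- The Rayleigh quotient is minimized jointly over the state and the unit vector. Its minimum is
  -- the candidate for `β`.
  obtain ⟨⟨x₀, w₀⟩, ⟨hx₀, hw₀⟩, hmin⟩ := (hX₁.prod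
    isCompact_setOf_dotProduct_self_eq_one).exists_isMinOn (hX₁ne.prod hsne) hcont.continuousOn
  replace hw₀ : w₀ ⬝ᵥ w₀ = 1 := hw₀
  have hw₀ne : w₀ ≠ 0 := fun h => by simp [h] at hw₀
  set β := w₀ ⬝ᵥ lyapMatrix rob κ α x₀.1 *ᵥ w₀ with hβ
  have hlow : ∀ x ∈ X₁, ∀ w, β * (w ⬝ᵥ w) ≤ w ⬝ᵥ lyapMatrix rob κ α x.1 *ᵥ w := by
    intro x hx w
    rcases eq_or_ne w 0 with rfl | hw
    · simp
    have hpos : 0 < w ⬝ᵥ w := by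
      have h0 : 0 ≤ w ⬝ᵥ w := by simpa using dotProduct_star_self_nonneg w
      exact lt_of_le_of_ne h0 fun h => hw (dotProduct_self_eq_zero.1 h.symm)
    set r := √(w ⬝ᵥ w)
    have hr : r ^ 2 = w ⬝ᵥ w := Real.sq_sqrt hpos.le
    have hr0 : r ≠ 0 := (Real.sqrt_pos.2 hpos).ne'
    have hunit : (r⁻¹ • w) ⬝ᵥ (r⁻¹ • w) = 1 := by
      rw [smul_dotProduct, dotProduct_smul, ← hr, smul_eq_mul, smul_eq_mul]
      field_simp
    have h := hmin (show (x, r⁻¹ • w) ∈ X₁ ×ˢ {w : Coord n ⊕ Fin 3 → ℝ | w ⬝ᵥ w = 1} from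
      ⟨hx, hunit⟩)
    simp only [mem_ofPred_eq] at h
    rw [← hquad x₀ hx₀, ← hquad x hx, ← hβ, Matrix.mulVec_smul, smul_dotProduct, dotProduct_smul,
      smul_eq_mul, smul_eq_mul] at h
    rw [← hr]
    calc β * r ^ 2 ≤ (r⁻¹ * (r⁻¹ * (w ⬝ᵥ lyapMatrix rob κ α x.1 *ᵥ w))) * r ^ 2 := by gcongr
      _ = _ := by field_simp
  refine ⟨β, ?_, ⟨⟨x₀, hx₀, ?_⟩, ?_⟩, hlow⟩
  · rw [hβ, hquad x₀ hx₀]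
    refine lyapQuad_pos hκ hα hα' (hM x₀ hx₀) ?_
    by_contra! h
    refine hw₀ne (funext fun i => ?_)
    cases i with
    | inl i => exact congrFun h.1 i
    | inr i => exact congrFun h.2 i
  -- The matrix `P - β` is positive semidefinite and its form vanishes at `w₀`, so `w₀` lies in its
  -- kernel and is an eigenvector of `P`.
  · have hpsd : (lyapMatrix rob κ α x₀.1 - β • 1).PosSemidef := by
      refine Matrix.PosSemidef.of_dotProduct_mulVec_nonneg
        ((lyapMatrix_isHermitian (hM x₀ hx₀)).sub ?_) fun w => ?_
      · simp [Matrix.IsHermitian]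
      · have := hlow x₀ hx₀ w
        simp only [star_trivial, Matrix.sub_mulVec, Matrix.smul_mulVec, Matrix.one_mulVec,
          dotProduct_sub, dotProduct_smul, smul_eq_mul]
        linarith
    have hzero := (hpsd.dotProduct_mulVec_zero_iff w₀).1 (by
      simp only [star_trivial, Matrix.sub_mulVec, Matrix.smul_mulVec, Matrix.one_mulVec,
          dotProduct_sub, dotProduct_smul, smul_eq_mul, hw₀, mul_one, ← hβ, sub_self])
    refine Module.End.hasEigenvalue_of_hasEigenvector (x := w₀)
      ⟨Module.End.mem_eigenspace_iff.2 ?_, hw₀ne⟩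
    rw [Matrix.sub_mulVec, Matrix.smul_mulVec, Matrix.one_mulVec, sub_eq_zero] at hzero
    rw [Matrix.toLin'_apply, hzero]
  · rintro b ⟨x, hx, hb⟩
    obtain ⟨w, hw⟩ := hb.exists_hasEigenvector
    have h := hlow x hx w
    have happ := hw.apply_eq_smul
    rw [Matrix.toLin'_apply] at happ
    rw [happ, dotProduct_smul, smul_eq_mul] at h
    have h0 : 0 ≤ w ⬝ᵥ w := by simpa using dotProduct_star_self_nonneg w
    exact le_of_mul_le_mul_right h
      (lt_of_le_of_ne h0 fun h => hw.2 (dotProduct_self_eq_zero.1 h.symm))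

theorem continuous_otherQuad : Continuous fun z : (Conf n × Conf n) × V3 × V3 × Conf n =>
    otherQuad rob κ α KD z.1 (rob.com z.1.1 - z.2.1) z.2.2.1 z.2.2.2 := by
  have hcom : Continuous rob.com := continuous_pi fun k => (rob.contDiff_com k).continuous
  have hJ : Continuous rob.comJac := continuous_matrix fun k j => (rob.contDiff_comJac k j).continuous
  have hJd : Continuous fun x : Conf n × Conf n => rob.comJacDot x.1 x.2 :=
    continuous_matrix fun k j => (rob.contDiff_comJacDot k j).continuous
  have hC : Continuous fun x : Conf n × Conf n => rob.coriolis x.1 x.2 :=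
    continuous_matrix fun k j => (rob.contDiff_coriolis k j).continuous
  have hJ' : Continuous fun z : (Conf n × Conf n) × V3 × V3 × Conf n => rob.comJac z.1.1 :=
    hJ.comp (by fun_prop)
  have hJd' : Continuous fun z : (Conf n × Conf n) × V3 × V3 × Conf n =>
    rob.comJacDot z.1.1 z.1.2 := hJd.comp continuous_fst
  have hC' : Continuous fun z : (Conf n × Conf n) × V3 × V3 × Conf n =>
    rob.coriolis z.1.1 z.1.2 := hC.comp continuous_fst
  have he : Continuous fun z : (Conf n × Conf n) × V3 × V3 × Conf n => rob.com z.1.1 - z.2.1 :=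
    (hcom.comp (by fun_prop)).sub (by fun_prop)
  have hv : Continuous fun z : (Conf n × Conf n) × V3 × V3 × Conf n => z.1.2 := by fun_prop
  have hu : Continuous fun z : (Conf n × Conf n) × V3 × V3 × Conf n => z.2.2.1 := by fun_prop
  have hτ : Continuous fun z : (Conf n × Conf n) × V3 × V3 × Conf n => z.2.2.2 := by fun_prop
  have hc : ∀ {a b : Type} (A : Matrix a b ℝ),
      Continuous fun _ : (Conf n × Conf n) × V3 × V3 × Conf n => A := fun A => continuous_const
  have hJv := hJ'.matrix_mulVec hv
  have hKv := (hc KD).matrix_mulVec hv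
  have hE := (hc (Robot.baseIncl n)ᵀ).matrix_mulVec
    ((hc KD).matrix_mulVec ((hJ'.matrix_transpose.matrix_mulVec hu).sub hv))
  have hE' := (hc (Robot.baseIncl n)ᵀ).matrix_mulVec (hτ.sub (hC'.matrix_mulVec hv))
  exact (((((((continuous_const.mul (hu.dotProduct he)).add
    (continuous_const.mul ((hJd'.matrix_mulVec hv).dotProduct he))).add
    (continuous_const.mul (hE.dotProduct he))).add
    (continuous_const.mul (hE'.dotProduct he))).add
    (continuous_const.mul (hJv.dotProduct he))).add
    (continuous_const.mul ((hJ'.matrix_mulVec hKv).dotProduct hu))).sub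
    (continuous_const.mul (hJv.dotProduct hu))).add
    (continuous_const.mul (hv.dotProduct hτ))

/-- The supremum of the residual terms is finite. -/
theorem exists_isLUB_otherTerms (hKD : KDᵀ = KD) {X₁ : Set (Conf n × Conf n)} (hX₁ : IsCompact X₁)
    (hX₁ne : X₁.Nonempty) (hM : ∀ x ∈ X₁, (rob.massMatrix x.1).PosDef)
    {X₂ : Set V3} (hX₂ : IsCompact X₂) (hX₂ne : X₂.Nonempty)
    {U₂ : Set V3} (hU₂ : Bornology.IsBounded U₂) (hU₂ne : U₂.Nonempty)
    {D : Set (Conf n)} (hD : Bornology.IsBounded D) (hDne : D.Nonempty) :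
    ∃ S, IsLUB {r | ∃ x₁ ∈ X₁, ∃ x₂ ∈ X₂, ∃ u₂ ∈ U₂, ∃ τ ∈ D,
        r = otherTerms rob κ α KD x₁ x₂ u₂ τ} S := by
  obtain ⟨x₁, hx₁⟩ := hX₁ne
  obtain ⟨x₂, hx₂⟩ := hX₂ne
  obtain ⟨u₂, hu₂⟩ := hU₂ne
  obtain ⟨τ, hτ⟩ := hDne
  refine ⟨_, isLUB_csSup ⟨_, x₁, hx₁, x₂, hx₂, u₂, hu₂, τ, hτ, rfl⟩ ?_⟩
  -- `U₂` and `D` are merely bounded. Their closures can be used because the reduced residual is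
  -- continuous everywhere.
  have hcomp := hX₁.prod (hX₂.prod (hU₂.isCompact_closure.prod hD.isCompact_closure))
  refine (hcomp.bddAbove_image
    (continuous_otherQuad (rob := rob) (κ := κ) (α := α) (KD := KD)).continuousOn).mono ?_
  rintro _ ⟨x₁, hx₁, x₂, hx₂, u₂, hu₂, τ, hτ, rfl⟩
  exact ⟨(x₁, x₂, u₂, τ), ⟨hx₁, hx₂, subset_closure hu₂, subset_closure hτ⟩,
    (otherTerms_eq hKD (hM x₁ hx₁) x₂ u₂ τ).symm⟩

/-- The residual terms vanish at rest with `x₂` at the center of mass. -/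
theorem otherTerms_rest (hKD : KDᵀ = KD) {q : Conf n} (hM : (rob.massMatrix q).PosDef) (u : V3)
    (τ : Conf n) : otherTerms rob κ α KD (q, 0) (rob.com q) u τ = 0 := by
  rw [otherTerms_eq hKD (x₁ := (q, 0)) hM]
  simp [otherQuad]

theorem lyapFn_rest {q : Conf n} (hM : (rob.massMatrix q).PosDef) :
    lyapFn rob κ α (q, 0) (rob.com q) = 0 := by
  rw [lyapFn_eq (x₁ := (q, 0)) hM]
  simp [lyapQuad]

/-- From `β (vᵀ v + eᵀ e) ≤ 𝒱 ≤ c`, dropping the velocity part. -/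
theorem norm_sub_le_of_lyapFn_le {β c : ℝ} (hβ : 0 < β) {x₁ : Conf n × Conf n} {x₂ : V3}
    (hlow : ∀ w, β * (w ⬝ᵥ w) ≤ w ⬝ᵥ lyapMatrix rob κ α x₁.1 *ᵥ w)
    (hV : lyapFn rob κ α x₁ x₂ ≤ c) :
    ‖(WithLp.toLp 2 (rob.com x₁.1) : Y3) - WithLp.toLp 2 x₂‖ ≤ √(1 / β * c) := by
  refine Real.le_sqrt_of_sq_le ?_
  have h1 := (hlow (Sum.elim x₁.2 (rob.com x₁.1 - x₂))).trans hV
  rw [sumElim_dotProduct_sumElim] at h1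
  have h2 : 0 ≤ x₁.2 ⬝ᵥ x₁.2 := by simpa using dotProduct_star_self_nonneg x₁.2
  have h3 : ‖(WithLp.toLp 2 (rob.com x₁.1) : Y3) - WithLp.toLp 2 x₂‖ ^ 2
      = (rob.com x₁.1 - x₂) ⬝ᵥ (rob.com x₁.1 - x₂) := by
    rw [← WithLp.toLp_sub, EuclideanSpace.norm_sq_eq]
    simp [dotProduct, sq]
  rw [h3, one_div, ← div_eq_inv_mul, le_div_iff₀ hβ]
  nlinarith

/-- The sublevel set of the Lyapunov-like function is invariant along the closed loop. -/
theorem lyapFn_le_of_isClosedLoopOn {grav : ℝ} {K : Matrix (Fin 3) (Fin 3) ℝ} (hκ : 0 < κ)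
    (hα : 0 < α) (hKD : KDᵀ = KD) {T S : ℝ} (hT : 0 ≤ T) {x₃ : ℝ → LipState} {d : ℝ → Conf n}
    {x₁ : ℝ → Conf n × Conf n} {x₂ : ℝ → V3}
    (hcl : IsClosedLoopOn rob grav κ KD K (Icc 0 T) x₃ d x₁ x₂)
    (hM : ∀ t ∈ Icc 0 T, (rob.massMatrix (x₁ t).1).PosDef)
    (hαM : ∀ t ∈ Icc 0 T, ((1 / κ) • KD - α • ((rob.comJac (x₁ t).1)ᵀ *
      rob.taskInertia (x₁ t).1 * rob.comJac (x₁ t).1) - α • rob.massMatrix (x₁ t).1).PosSemidef)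
    (hS : ∀ t ∈ Icc 0 T,
      otherTerms rob κ α KD (x₁ t) (x₂ t) (lipInterface K (x₂ t) (x₃ t)) (d t) ≤ S)
    (h0 : lyapFn rob κ α (x₁ 0) (x₂ 0) ≤ S / (2 * α * κ)) :
    lyapFn rob κ α (x₁ T) (x₂ T) ≤ S / (2 * α * κ) := by
  have h0mem : (0 : ℝ) ∈ Icc 0 T := left_mem_Icc.2 hT
  have hTmem : T ∈ Icc 0 T := right_mem_Icc.2 hT
  obtain ⟨hcl₁, hcl₂⟩ := hcl
  have hint₁ := (hcl₁ T hTmem).2.2.2.1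
  have hint₂ := (hcl₂ T hTmem).2.2.2.1
  have heq₁ := fun t ht => (hcl₁ t ht).2.2.2.2
  have heq₂ := fun t ht => (hcl₂ t ht).2.2.2.2
  rw [lyapFn_eq (hM 0 h0mem)] at h0
  rw [lyapFn_eq (hM T hTmem)]
  have hsmooth : ContDiff ℝ ∞ fun x : (Conf n × Conf n) × V3 =>
      lyapQuad rob κ α x.1.1 x.1.2 (rob.com x.1.1 - x.2) := by
    have hcom : ContDiff ℝ ∞ fun x : (Conf n × Conf n) × V3 => rob.com x.1.1 - x.2 :=
      ((contDiff_pi.2 rob.contDiff_com).comp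
        (by fun_prop : ContDiff ℝ ∞ fun x : (Conf n × Conf n) × V3 => x.1.1)).sub contDiff_snd
    exact (contDiff_lyapQuad (rob := rob) (κ := κ) (α := α)).comp (contDiff_fst.prodMk hcom)
  have hAC := (hsmooth.of_le (by simp)).comp_absolutelyContinuousOnInterval
    ((absolutelyContinuousOnInterval_of_eq_integral hT hint₁ heq₁).prodMk
      (absolutelyContinuousOnInterval_of_eq_integral hT hint₂ heq₂))
  refine AbsolutelyContinuousOnInterval.le_of_ae_hasDerivAt_le (a := 2 * α * κ)
    (h := fun t => lyapQuad rob κ α (x₁ t).1 (x₁ t).2 (rob.com (x₁ t).1 - x₂ t)) hT hAC ?_ h0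
  filter_upwards [ae_hasDerivAt_of_eq_integral hT hint₁ heq₁,
    ae_hasDerivAt_of_eq_integral hT hint₂ heq₂] with t ht₁ ht₂ hmem
  have hd₁ := ht₁ hmem
  have hd₂ := ht₂ hmem
  have hq : HasDerivAt (fun s => (x₁ s).1) (x₁ t).2 t :=
    (ContinuousLinearMap.fst ℝ (Conf n) (Conf n)).hasFDerivAt.comp_hasDerivAt t hd₁
  have hv : HasDerivAt (fun s => (x₁ s).2) _ t :=
    (ContinuousLinearMap.snd ℝ (Conf n) (Conf n)).hasFDerivAt.comp_hasDerivAt t hd₁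
  refine ⟨_, hasDerivAt_lyapQuad hq hv hd₂, ?_⟩
  refine (deriv_lyapQuad_le (d := d t) hκ hKD (hM t hmem) (hαM t hmem) ?_).trans ?_
  -- Multiplication by `M` recovers the equation of motion, in which the gravity compensation of the
  -- interface cancels `τ_g`.
  · have hdet := (Matrix.isUnit_iff_isUnit_det _).1 (hM t hmem).isUnit
    change rob.massMatrix (x₁ t).1 *ᵥ ((rob.massMatrix (x₁ t).1)⁻¹ *ᵥ _) = _
    rw [Matrix.mulVec_mulVec, Matrix.mul_nonsing_inv _ hdet, Matrix.one_mulVec]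
    simp only [energyInterface, comModel]
    abel
  · have hOT := hS t hmem
    rw [otherTerms_eq hKD (hM t hmem)] at hOT
    rw [mul_sub, mul_div_cancel₀ _ (by positivity)]
    change _ + otherQuad rob κ α KD (x₁ t) _ (lipInterface K (x₂ t) (x₃ t)) (d t) ≤ _
    linarith

end Bounds

/-! ### The center of mass model and the pendulum -/

section Pendulum

theorem continuousOn_Ici_of_Icc {X : Type*} [TopologicalSpace X] {x : ℝ → X}
    (h : ∀ T, 0 ≤ T → ContinuousOn x (Icc 0 T)) : ContinuousOn x (Ici 0) := by
  intro t ht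
  have ht' : (0 : ℝ) ≤ t := ht
  refine (h (t + 1) (by linarith) t ⟨ht', by linarith⟩).mono_of_mem_nhdsWithin ?_
  filter_upwards [self_mem_nhdsWithin, mem_nhdsWithin_of_mem_nhds (Iic_mem_nhds
    (lt_add_one t))] with s hs hs' using ⟨hs, hs'⟩

namespace ControlSystem.IsTrajectoryOn

variable {X U W Y : Type*} [NormedAddCommGroup X] [NormedSpace ℝ X] {S : ControlSystem X U W Y}
  {u : ℝ → U} {d : ℝ → W} {x : ℝ → X}

theorem mono {I I' : Set ℝ} (h : S.IsTrajectoryOn I u d x) (hI : I' ⊆ I) :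
    S.IsTrajectoryOn I' u d x := fun t ht => h t (hI ht)

theorem absolutelyContinuousOnInterval {T : ℝ} (hT : 0 ≤ T)
    (h : S.IsTrajectoryOn (Icc 0 T) u d x) : AbsolutelyContinuousOnInterval x 0 T :=
  absolutelyContinuousOnInterval_of_eq_integral hT (h T (right_mem_Icc.2 hT)).2.2.2.1
    fun t ht => (h t ht).2.2.2.2

theorem continuousOn_Ici (h : S.IsTrajectoryOn (Ici 0) u d x) : ContinuousOn x (Ici 0) :=
  continuousOn_Ici_of_Icc fun T hT => by
    have := ((h.mono Icc_subset_Ici_self).absolutelyContinuousOnInterval hT).continuousOn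
    rwa [uIcc_of_le hT] at this

end ControlSystem.IsTrajectoryOn

variable {grav h : ℝ} {X₃ : Set LipState} {U₃ : Set (Fin 2 → ℝ)} {K : Matrix (Fin 3) (Fin 3) ℝ}

theorem lipModel_g (x₃ : LipState) : (lipModel grav h X₃ U₃).g x₃ = WithLp.toLp 2 (lipPos x₃) := by
  simp only [lipModel, lipC]
  congr 1
  ext k
  simp [Matrix.mulVec, dotProduct, lipPos, Matrix.one_apply]

/-- The center of pressure acts on the velocity only. This is why the interface can track `p`
without knowing `u₃`. -/
theorem lipPos_lipModel_f (x : LipState) (u : Fin 2 → ℝ) (d : Unit) :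
    lipPos ((lipModel grav h X₃ U₃).f x u d) = lipVel x := by
  ext k
  simp [lipModel, lipPos, lipVel, lipA, lipB, Matrix.mulVec, dotProduct, Matrix.one_apply]

theorem continuous_lipPos : Continuous lipPos := continuous_pi fun _ => continuous_apply _

theorem continuous_lipVel : Continuous lipVel := continuous_pi fun _ => continuous_apply _

theorem lipPos_eq_integral {I : Set ℝ} {u₃ : ℝ → Fin 2 → ℝ} {x₃ : ℝ → LipState}
    (hx₃ : (lipModel grav h X₃ U₃).IsTrajectoryOn I u₃ (fun _ => ()) x₃) {t : ℝ} (ht : t ∈ I) :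
    IntervalIntegrable (fun s => lipVel (x₃ s)) volume 0 t ∧
      lipPos (x₃ t) = lipPos (x₃ 0) + ∫ s in (0 : ℝ)..t, lipVel (x₃ s) := by
  obtain ⟨-, -, -, hint, heq⟩ := hx₃ t ht
  let L : LipState →L[ℝ] V3 := ContinuousLinearMap.pi fun k => ContinuousLinearMap.proj (Sum.inl k)
  have hL : ∀ x, L x = lipPos x := fun x => rfl
  have hLf : ∀ s, L ((lipModel grav h X₃ U₃).f (x₃ s) (u₃ s) ()) = lipVel (x₃ s) := fun s => by
    rw [hL, lipPos_lipModel_f]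
  have hcomm := L.intervalIntegral_comp_comm hint
  simp only [hLf] at hcomm
  refine ⟨?_, ?_⟩
  · have hi : IntervalIntegrable
        (fun s => L ((lipModel grav h X₃ U₃).f (x₃ s) (u₃ s) ())) volume 0 t :=
      ⟨L.integrable_comp hint.1, L.integrable_comp hint.2⟩
    simpa only [hLf] using hi
  · rw [← hL, heq, map_add, hcomm, hL]

section Exponential

open scoped Matrix.Norms.L2Operator

theorem hasDerivAt_exp_smul_mulVec (K : Matrix (Fin 3) (Fin 3) ℝ) (z : V3) (t : ℝ) :
    HasDerivAt (fun t : ℝ => NormedSpace.exp (t • K) *ᵥ z)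
      (K *ᵥ (NormedSpace.exp (t • K) *ᵥ z)) t := by
  let L : Matrix (Fin 3) (Fin 3) ℝ →L[ℝ] V3 :=
    ((Matrix.mulVecBilin ℝ ℝ).flip z).toContinuousLinearMap
  have hL : ∀ A, L A = A *ᵥ z := fun A => rfl
  have hd := L.hasFDerivAt.comp_hasDerivAt t (hasDerivAt_exp_smul_const' K t)
  refine hd.congr_deriv ?_
  rw [hL, Matrix.mulVec_mulVec]

theorem exp_add_smul_mulVec (K : Matrix (Fin 3) (Fin 3) ℝ) (z : V3) (s t : ℝ) :
    NormedSpace.exp (s • K) *ᵥ (NormedSpace.exp (t • K) *ᵥ z)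
      = NormedSpace.exp ((s + t) • K) *ᵥ z := by
  rw [Matrix.mulVec_mulVec, add_smul, Matrix.exp_add_of_commute]
  exact ((Commute.refl K).smul_left s).smul_right t

end Exponential

/-- The tracking solution of the center of mass model under the linear interface. -/
def lipTrack (K : Matrix (Fin 3) (Fin 3) ℝ) (x₃ : ℝ → LipState) (z : V3) (t : ℝ) : V3 :=
  lipPos (x₃ t) + NormedSpace.exp (t • K) *ᵥ z

theorem lipTrack_zero (x₃ : ℝ → LipState) (z : V3) : lipTrack K x₃ z 0 = lipPos (x₃ 0) + z := by
  simp [lipTrack, NormedSpace.exp_zero]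

theorem continuous_exp_smul_mulVec (K : Matrix (Fin 3) (Fin 3) ℝ) (z : V3) :
    Continuous fun t : ℝ => NormedSpace.exp (t • K) *ᵥ z :=
  continuous_iff_continuousAt.2 fun t => (hasDerivAt_exp_smul_mulVec K z t).continuousAt

/-- The two summands have derivatives `v` and `K exp (t K) z = K (x₂ - p)`, whose sum is the
interface. -/
theorem isTrajectoryOn_lipTrack {I : Set ℝ} {u₃ : ℝ → Fin 2 → ℝ} {x₃ : ℝ → LipState}
    (hx₃ : (lipModel grav h X₃ U₃).IsTrajectoryOn I u₃ (fun _ => ()) x₃) (z : V3) (d : ℝ → Unit) :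
    comModel.IsTrajectoryOn I (fun t => lipInterface K (lipTrack K x₃ z t) (x₃ t)) d
      (lipTrack K x₃ z) := by
  intro t ht
  obtain ⟨hint, heq⟩ := lipPos_eq_integral hx₃ ht
  have hf : ∀ s, lipInterface K (lipTrack K x₃ z s) (x₃ s)
      = lipVel (x₃ s) + K *ᵥ (NormedSpace.exp (s • K) *ᵥ z) := fun s => by
    simp [lipInterface, lipTrack]
  have hcont : Continuous fun s : ℝ => K *ᵥ (NormedSpace.exp (s • K) *ᵥ z) :=
    Continuous.matrix_mulVec continuous_const (continuous_exp_smul_mulVec K z)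
  refine ⟨mem_univ _, mem_univ _, mem_univ _, ?_, ?_⟩
  · simp only [comModel, hf]
    exact hint.add (hcont.intervalIntegrable _ _)
  · simp only [comModel, hf]
    rw [intervalIntegral.integral_add hint (hcont.intervalIntegrable _ _),
      intervalIntegral.integral_eq_sub_of_hasDerivAt
        (fun s _ => hasDerivAt_exp_smul_mulVec K z s) (hcont.intervalIntegrable _ _),
      lipTrack_zero, lipTrack, heq]
    simp only [zero_smul, NormedSpace.exp_zero, Matrix.one_mulVec]
    abel

/-- A crude growth constant, enough for the Grönwall argument behind uniqueness. -/
theorem dotProduct_mulVec_self_le {ι : Type*} [Fintype ι] (K : Matrix ι ι ℝ) (z : ι → ℝ) :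
    z ⬝ᵥ K *ᵥ z ≤ (∑ i, ∑ j, |K i j|) * (z ⬝ᵥ z) := by
  have hz : ∀ i, z i ^ 2 ≤ z ⬝ᵥ z := fun i => by
    rw [sq]
    exact Finset.single_le_sum (f := fun i => z i * z i) (fun i _ => mul_self_nonneg (z i))
      (Finset.mem_univ i)
  have hsum : z ⬝ᵥ K *ᵥ z = ∑ i, ∑ j, K i j * (z i * z j) := by
    simp only [dotProduct, Matrix.mulVec, Finset.mul_sum]
    exact Finset.sum_congr rfl fun i _ => Finset.sum_congr rfl fun j _ => by ring
  rw [hsum, Finset.sum_mul]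
  simp only [Finset.sum_mul]
  refine Finset.sum_le_sum fun i _ => Finset.sum_le_sum fun j _ => ?_
  have h1 : |z i * z j| ≤ z ⬝ᵥ z := by
    have hi := hz i
    have hj := hz j
    rw [abs_le]
    constructor <;> nlinarith [sq_nonneg (z i + z j), sq_nonneg (z i - z j)]
  calc K i j * (z i * z j) ≤ |K i j| * |z i * z j| := by rw [← abs_mul]; exact le_abs_self _
    _ ≤ |K i j| * (z ⬝ᵥ z) := by gcongr

/-- A solution of `z' = K z` with `z 0 = 0` vanishes. -/
theorem eq_zero_of_eq_integral_mulVec {ι : Type*} [Fintype ι] {K : Matrix ι ι ℝ} {z : ℝ → ι → ℝ}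
    {T : ℝ} (hT : 0 ≤ T) (hint : IntervalIntegrable (fun s => K *ᵥ z s) volume 0 T)
    (hz : ∀ t ∈ Icc 0 T, z t = z 0 + ∫ s in (0 : ℝ)..t, K *ᵥ z s) (h0 : z 0 = 0) : z T = 0 := by
  have hsm : ContDiff ℝ 1 fun w : ι → ℝ => w ⬝ᵥ w :=
    contDiff_dotProduct (fun i => by fun_prop) fun i => by fun_prop
  have hAC := hsm.comp_absolutelyContinuousOnInterval
    (absolutelyContinuousOnInterval_of_eq_integral hT hint hz)
  have hle : z T ⬝ᵥ z T ≤ 0 := by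
    -- Grönwall in the form of the comparison principle with `c = 0` and a nonpositive rate.
    refine AbsolutelyContinuousOnInterval.le_of_ae_hasDerivAt_le
      (h := fun t => z t ⬝ᵥ z t) (a := -(2 * ∑ i, ∑ j, |K i j|)) hT hAC ?_ (by simp [h0])
    filter_upwards [ae_hasDerivAt_of_eq_integral hT hint hz] with t ht hmem
    refine ⟨_, (ht hmem).dotProduct' (ht hmem), ?_⟩
    rw [dotProduct_comm (K *ᵥ z t)]
    have := dotProduct_mulVec_self_le K (z t)
    linarith
  have hge : 0 ≤ z T ⬝ᵥ z T := by simpa using dotProduct_star_self_nonneg (z T)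
  exact dotProduct_self_eq_zero.1 (le_antisymm hle hge)

/-- Under the linear interface the tracking error evolves by the exponential of `K`. -/
theorem eq_lipTrack {T : ℝ} (hT : 0 ≤ T) {u₃ : ℝ → Fin 2 → ℝ} {x₃ : ℝ → LipState}
    (hx₃ : (lipModel grav h X₃ U₃).IsTrajectoryOn (Icc 0 T) u₃ (fun _ => ()) x₃) {x₂ : ℝ → V3}
    (hx₂ : comModel.IsTrajectoryOn (Icc 0 T) (fun t => lipInterface K (x₂ t) (x₃ t))
      (fun _ => ()) x₂) : x₂ T = lipTrack K x₃ (x₂ 0 - lipPos (x₃ 0)) T := by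
  set y := lipTrack K x₃ (x₂ 0 - lipPos (x₃ 0)) with hy
  have hy' : comModel.IsTrajectoryOn (Icc 0 T) (fun t => lipInterface K (y t) (x₃ t))
    (fun _ => ()) y := isTrajectoryOn_lipTrack hx₃ _ _
  have hy0 : y 0 = x₂ 0 := by rw [hy, lipTrack_zero, add_sub_cancel]
  -- The pendulum terms cancel, so the difference from the explicit solution is autonomous and
  -- linear.
  have hf : ∀ s, lipInterface K (x₂ s) (x₃ s) - lipInterface K (y s) (x₃ s)
      = K *ᵥ (x₂ s - y s) := fun s => by
    simp only [lipInterface, add_sub_add_left_eq_sub, ← Matrix.mulVec_sub,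
      sub_sub_sub_cancel_right]
  have hint : ∀ t ∈ Icc 0 T, IntervalIntegrable (fun s => K *ᵥ (x₂ s - y s)) volume 0 t ∧
      x₂ t - y t = (x₂ 0 - y 0) + ∫ s in (0 : ℝ)..t, K *ᵥ (x₂ s - y s) := fun t ht => by
    obtain ⟨-, -, -, hi, he⟩ := hx₂ t ht
    obtain ⟨-, -, -, hi', he'⟩ := hy' t ht
    have hi'' := hi.sub hi'
    have hsub := intervalIntegral.integral_sub hi hi'
    simp only [comModel, hf] at hi'' hsub
    refine ⟨hi'', ?_⟩
    rw [hsub, he, he']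
    simp only [comModel]
    abel
  have := eq_zero_of_eq_integral_mulVec (z := fun s => x₂ s - y s) hT
    (hint T (right_mem_Icc.2 hT)).1 (fun t ht => (hint t ht).2) (by simp [hy0])
  exact sub_eq_zero.1 this

/-- The relation between the center of mass model and the pendulum: the autonomous tracking error
`exp (t K) (x₂ - p)` stays within `ε`. -/
def lipRel (K : Matrix (Fin 3) (Fin 3) ℝ) (ε : ℝ) (x₂ : V3) (x₃ : LipState) : Prop :=
  ∀ t : ℝ, 0 ≤ t →
    ‖(WithLp.toLp 2 (NormedSpace.exp (t • K) *ᵥ (x₂ - lipPos x₃)) : Y3)‖ ≤ ε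

theorem lipRel.norm_sub_le {ε : ℝ} {x₂ : V3} {x₃ : LipState} (hR : lipRel K ε x₂ x₃) :
    ‖comModel.g x₂ - (lipModel grav h X₃ U₃).g x₃‖ ≤ ε := by
  have h0 := hR 0 le_rfl
  rw [zero_smul, NormedSpace.exp_zero, Matrix.one_mulVec] at h0
  rwa [lipModel_g]

/-- By the semigroup law, the future orbit of the error at time `t` is a tail of its original orbit.
-/
theorem lipRel.lipTrack {ε : ℝ} {x₃ : ℝ → LipState} {x₂₀ : V3} (hR : lipRel K ε x₂₀ (x₃ 0))
    {t : ℝ} (ht : 0 ≤ t) : lipRel K ε (lipTrack K x₃ (x₂₀ - lipPos (x₃ 0)) t) (x₃ t) := by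
  intro s hs
  rw [_root_.lipTrack, add_sub_cancel_left, exp_add_smul_mulVec]
  exact hR (s + t) (by positivity)

theorem exists_lipRel_of_norm_le (hK : IsHurwitz K) {ε : ℝ} (hε : 0 < ε) :
    ∃ δ > 0, ∀ x₂ x₃, ‖comModel.g x₂ - (lipModel grav h X₃ U₃).g x₃‖ ≤ δ → lipRel K ε x₂ x₃ := by
  obtain ⟨C, hC, hexp⟩ := hK.exists_norm_exp_mulVec_le
  refine ⟨ε / C, by positivity, fun x₂ x₃ hle t ht => ?_⟩
  rw [lipModel_g] at hle
  calc _ ≤ C * ‖(WithLp.toLp 2 (x₂ - lipPos x₃) : Y3)‖ := hexp t ht _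
    _ ≤ C * (ε / C) := mul_le_mul_of_nonneg_left hle hC.le
    _ = ε := mul_div_cancel₀ _ hC.ne'

theorem lipRel.of_isTrajectoryOn {ε T : ℝ} (hT : 0 ≤ T) {u₃ : ℝ → Fin 2 → ℝ}
    {x₃ : ℝ → LipState}
    (hx₃ : (lipModel grav h X₃ U₃).IsTrajectoryOn (Icc 0 T) u₃ (fun _ => ()) x₃) {x₂ : ℝ → V3}
    (hx₂ : comModel.IsTrajectoryOn (Icc 0 T) (fun t => lipInterface K (x₂ t) (x₃ t))
      (fun _ => ()) x₂) (hR : lipRel K ε (x₂ 0) (x₃ 0)) : lipRel K ε (x₂ T) (x₃ T) := by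
  rw [eq_lipTrack hT hx₃ hx₂]
  exact hR.lipTrack hT

theorem isRobustApproxSimRel_lipRel (ε : ℝ) :
    IsRobustApproxSimRel comModel (lipModel grav h X₃ U₃) (lipRel K ε) ε := by
  refine fun x₂₀ x₃₀ hR => ⟨hR.norm_sub_le, fun d _ u₃ x₃ hx₃ h0 => ?_⟩
  subst h0
  exact ⟨_, _, isTrajectoryOn_lipTrack hx₃ (x₂₀ - lipPos (x₃ 0)) d,
    by rw [lipTrack_zero, add_sub_cancel], fun t ht => hR.lipTrack ht⟩

end Pendulum

/-! ### Existence of closed-loop solutions -/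

section Existence

/-- A map that is `C¹` near a compact set agrees there with a globally Lipschitz map. -/
theorem IsCompact.exists_lipschitzWith_eqOn {E ι κ : Type*} [NormedAddCommGroup E]
    [NormedSpace ℝ E] [Fintype ι] [Fintype κ] {s : Set E} (hs : IsCompact s)
    {f : E → (ι → ℝ) × (κ → ℝ)} (hf : ∀ x ∈ s, ContDiffAt ℝ 1 f x) :
    ∃ L, ∃ g : E → (ι → ℝ) × (κ → ℝ), LipschitzWith L g ∧ EqOn f g s := by
  have hloc : LocallyLipschitzOn s f := fun x hx => by
    obtain ⟨L, t, ht, hL⟩ := (hf x hx).exists_lipschitzOnWith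
    exact ⟨L, t, mem_nhdsWithin_of_mem_nhds ht, hL⟩
  obtain ⟨L, hL⟩ := hloc.exists_lipschitzOnWith_of_compact hs
  -- Lipschitz functions into a finite product of lines extend coordinate by coordinate, so each
  -- factor is extended separately.
  obtain ⟨g₁, hg₁, he₁⟩ := (LipschitzWith.prod_fst.comp_lipschitzOnWith hL).extend_pi
  obtain ⟨g₂, hg₂, he₂⟩ := (LipschitzWith.prod_snd.comp_lipschitzOnWith hL).extend_pi
  exact ⟨_, fun x => (g₁ x, g₂ x), hg₁.prodMk hg₂, fun x hx => Prod.ext (he₁ hx) (he₂ hx)⟩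

/-- Global solutions of `x' = g₀ x + ∑ wⱼ(t) gⱼ x` with Lipschitz fields and measurable, locally
bounded coefficients. -/
theorem exists_solution_of_lipschitz_affine {E ι : Type*} [NormedAddCommGroup E] [NormedSpace ℝ E]
    [CompleteSpace E] [Fintype ι] {g₀ : E → E} {g : ι → E → E} {L₀ : NNReal} {L : ι → NNReal}
    (hg₀ : LipschitzWith L₀ g₀) (hg : ∀ j, LipschitzWith (L j) (g j)) {w : ℝ → ι → ℝ}
    (hw : ∀ j, AEStronglyMeasurable (fun t => w t j) (volume.restrict (Ici 0)))
    (hb : ∀ T, ∃ B, ∀ t ∈ Icc 0 T, ∀ j, |w t j| ≤ B) (x₀ : E) :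
    ∃ x : ℝ → E, Continuous x ∧ x 0 = x₀ ∧ ∀ t, 0 ≤ t →
      IntervalIntegrable (fun s => g₀ (x s) + ∑ j, w s j • g j (x s)) volume 0 t ∧
      x t = x₀ + ∫ s in (0 : ℝ)..t, (g₀ (x s) + ∑ j, w s j • g j (x s)) := by
  refine exists_caratheodory_solution (F := fun t x => g₀ x + ∑ j, w t j • g j x)
    (fun x hx => ?_) (fun T => ?_) (fun T => ?_)
  · refine (hg₀.continuous.comp hx).aestronglyMeasurable.add
      (Finset.aestronglyMeasurable_fun_sum _ fun j _ => ?_)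
    exact (hw j).smul ((hg j).continuous.comp hx).aestronglyMeasurable
  · obtain ⟨B, hB⟩ := hb T
    refine ⟨L₀ + ∑ j, B * L j, fun t ht x y => ?_⟩
    rw [add_sub_add_comm, ← Finset.sum_sub_distrib, add_mul, Finset.sum_mul]
    refine (norm_add_le _ _).trans (add_le_add ?_ ((norm_sum_le _ _).trans
      (Finset.sum_le_sum fun j _ => ?_)))
    · rw [← dist_eq_norm, ← dist_eq_norm]
      exact hg₀.dist_le_mul x y
    · rw [← smul_sub, norm_smul, Real.norm_eq_abs, mul_assoc]
      refine mul_le_mul (hB t ht j) ?_ (norm_nonneg _) ((abs_nonneg _).trans (hB t ht j))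
      rw [← dist_eq_norm, ← dist_eq_norm]
      exact (hg j).dist_le_mul x y
  · obtain ⟨B, hB⟩ := hb T
    refine ⟨‖g₀ x₀‖ + ∑ j, B * ‖g j x₀‖, fun t ht => ?_⟩
    refine (norm_add_le _ _).trans (add_le_add le_rfl ((norm_sum_le _ _).trans
      (Finset.sum_le_sum fun j _ => ?_)))
    rw [norm_smul, Real.norm_eq_abs]
    exact mul_le_mul_of_nonneg_right (hB t ht j) (norm_nonneg _)

theorem contDiffAt_inv_mulVec {E ι : Type*} [NormedAddCommGroup E] [NormedSpace ℝ E] [Fintype ι]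
    [DecidableEq ι] {r : WithTop ℕ∞} {A : E → Matrix ι ι ℝ} {v : E → ι → ℝ}
    (hA : ∀ i j, ContDiff ℝ r fun x => A x i j) (hv : ∀ i, ContDiff ℝ r fun x => v x i) {x : E}
    (hx : (A x).det ≠ 0) : ContDiffAt ℝ r (fun x => (A x)⁻¹ *ᵥ v x) x := by
  rw [contDiffAt_pi]
  intro i
  simp only [Matrix.mulVec, dotProduct]
  exact ContDiffAt.sum fun j _ => (contDiffAt_inv_apply hA hx i j).mul (hv j).contDiffAt

/-- If a continuous curve that starts in a closed set `A` stays in `A` as long as it stays in a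
neighborhood of `A`, then it stays in `A` forever. -/
theorem forall_mem_of_forall_mem_interior {X : Type*} [TopologicalSpace X] {x : ℝ → X}
    (hx : Continuous x) {A B : Set X} (hA : IsClosed A) (hAB : A ⊆ interior B) (h0 : x 0 ∈ A)
    (hstay : ∀ T, 0 ≤ T → (∀ t ∈ Icc 0 T, x t ∈ B) → ∀ t ∈ Icc 0 T, x t ∈ A) {t : ℝ}
    (ht : 0 ≤ t) : x t ∈ A := by
  -- For `t ≥ 0` this says that `x` stays in `A` on `[0, t]`. The rescaled form makes the set
  -- visibly closed, as needed for induction along the interval.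
  set S := {t : ℝ | ∀ r ∈ Icc (0 : ℝ) 1, x (r * t) ∈ A} with hS
  have hclosed : IsClosed S := by
    rw [hS, show {t : ℝ | ∀ r ∈ Icc (0 : ℝ) 1, x (r * t) ∈ A}
      = ⋂ r ∈ Icc (0 : ℝ) 1, {t | x (r * t) ∈ A} by ext; simp]
    exact isClosed_biInter fun r _ => hA.preimage (hx.comp (by fun_prop))
  have hmem : ∀ t, 0 ≤ t → (t ∈ S ↔ ∀ s ∈ Icc 0 t, x s ∈ A) := fun t ht => by
    constructor
    · intro h s hs
      rcases eq_or_lt_of_le ht with h0' | h0'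
      · have : s = 0 := le_antisymm (hs.2.trans h0'.ge) hs.1
        rwa [this]
      · have := h (s / t) ⟨by have := hs.1; positivity, (div_le_one h0').2 hs.2⟩
        rwa [div_mul_cancel₀ _ h0'.ne'] at this
    · intro h r hr
      exact h _ ⟨mul_nonneg hr.1 ht, mul_le_of_le_one_left ht hr.2⟩
  have htS : t ∈ S := by
    refine IsClosed.mem_of_ge_of_forall_exists_gt (a := 0) (b := t)
      (hclosed.inter isClosed_Icc) (by simpa [hS] using fun _ _ _ => h0) ht fun s hs => ?_
    have hs0 : 0 ≤ s := hs.2.1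
    have hsA := (hmem s hs0).1 hs.1
    have hnhds : x ⁻¹' interior B ∈ 𝓝 s :=
      (isOpen_interior.preimage hx).mem_nhds (hAB (hsA s ⟨hs0, le_rfl⟩))
    obtain ⟨η, hη, hball⟩ := Metric.mem_nhds_iff.1 hnhds
    -- Up to `s` the curve is in `A`, and up to `s'` it remains in the open set around `x s` inside
    -- `B`. Then `hstay` brings it back into `A` on all of `[0, s']`.
    set s' := min t (s + η / 2)
    have hss' : s < s' := lt_min hs.2.2 (by linarith)
    have hs'0 : 0 ≤ s' := hs0.trans hss'.le
    refine ⟨s', (hmem s' hs'0).2 (hstay s' hs'0 fun r hr => ?_), hss', min_le_left _ _⟩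
    rcases le_total r s with h | h
    · exact interior_subset (hAB (hsA r ⟨hr.1, h⟩))
    · refine interior_subset (hball ?_)
      rw [Metric.mem_ball, Real.dist_eq, abs_of_nonneg (by linarith)]
      have : r ≤ s + η / 2 := hr.2.trans (min_le_right _ _)
      linarith
  exact (hmem t ht).1 htS t ⟨ht, le_rfl⟩

variable {n N : ℕ} {rob : Robot n N}

/-- The part of the closed-loop whole-body dynamics that depends on the state alone. -/
def closedLoopDrift (rob : Robot n N) (κ : ℝ) (KD : Matrix (Coord n) (Coord n) ℝ)
    (x : Conf n × Conf n) : Conf n × Conf n :=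
  (x.2, (rob.massMatrix x.1)⁻¹ *ᵥ (-((2 * κ) • ((rob.comJac x.1)ᵀ *ᵥ rob.com x.1))
    - KD *ᵥ x.2 - rob.coriolis x.1 x.2 *ᵥ x.2))

/-- The generalized forces through which `x₂`, `u₂` and the disturbance enter the closed loop. -/
def closedLoopInput (rob : Robot n N) (κ : ℝ) (KD : Matrix (Coord n) (Coord n) ℝ) (q : Conf n) :
    Matrix (Coord n) (Fin 3 ⊕ Fin 3 ⊕ Coord n) ℝ :=
  Matrix.fromCols ((2 * κ) • (rob.comJac q)ᵀ) (Matrix.fromCols (KD * (rob.comJac q)ᵀ) 1)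

/-- The vector field of the `j`-th coordinate of `(x₂, u₂, d)`. -/
def closedLoopField (rob : Robot n N) (κ : ℝ) (KD : Matrix (Coord n) (Coord n) ℝ)
    (j : Fin 3 ⊕ Fin 3 ⊕ Coord n) (x : Conf n × Conf n) : Conf n × Conf n :=
  (0, (rob.massMatrix x.1)⁻¹ *ᵥ fun i => closedLoopInput rob κ KD x.1 i j)

/-- After gravity compensation the closed loop is affine in `(x₂, u₂, d)`. This separates the time
dependence, merely measurable in `d`, from fields of the state that are smooth wherever `M` is
invertible. -/
theorem wholeBodyModel_f_energyInterface (grav κ : ℝ) (KD : Matrix (Coord n) (Coord n) ℝ)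
    (X₁ : Set (Conf n × Conf n)) (D : Set (Conf n)) (x : Conf n × Conf n) (x₂ u₂ : V3)
    (d : Conf n) :
    (wholeBodyModel rob grav X₁ D).f x (energyInterface rob grav κ KD x x₂ u₂) d
      = closedLoopDrift rob κ KD x
        + ∑ j, Sum.elim x₂ (Sum.elim u₂ d) j • closedLoopField rob κ KD j x := by
  have hsum : ∑ j, Sum.elim x₂ (Sum.elim u₂ d) j • closedLoopField rob κ KD j x
      = (0, (rob.massMatrix x.1)⁻¹ *ᵥ
        (closedLoopInput rob κ KD x.1 *ᵥ Sum.elim x₂ (Sum.elim u₂ d))) := by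
    refine Prod.ext ?_ ?_
    · simp [Prod.fst_sum, closedLoopField]
    · simp only [Prod.snd_sum, closedLoopField, Prod.smul_snd, ← Matrix.mulVec_smul,
        ← Matrix.mulVec_sum]
      congr 1
      ext i
      simp [Matrix.mulVec, dotProduct, Finset.sum_apply, mul_comm]
  rw [hsum]
  refine Prod.ext (by simp [wholeBodyModel, closedLoopDrift]) ?_
  simp only [wholeBodyModel, closedLoopDrift, Prod.snd_add]
  rw [← Matrix.mulVec_add]
  congr 1
  simp only [closedLoopInput, Matrix.fromCols_mulVec, Sum.elim_comp_inl, Sum.elim_comp_inr,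
    energyInterface, Matrix.one_mulVec, Matrix.smul_mulVec, ← Matrix.mulVec_mulVec,
    Matrix.mulVec_sub, smul_sub]
  abel

theorem contDiffAt_closedLoopDrift (κ : ℝ) (KD : Matrix (Coord n) (Coord n) ℝ)
    {x : Conf n × Conf n} (hx : (rob.massMatrix x.1).det ≠ 0) :
    ContDiffAt ℝ ∞ (closedLoopDrift rob κ KD) x := by
  have hq : ContDiff ℝ ∞ fun x : Conf n × Conf n => x.1 := contDiff_fst
  have hv : ∀ i, ContDiff ℝ ∞ fun x : Conf n × Conf n => x.2 i := fun i => by fun_prop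
  refine contDiff_snd.contDiffAt.prodMk (contDiffAt_inv_mulVec
    (A := fun x : Conf n × Conf n => rob.massMatrix x.1)
    (fun i j => (rob.contDiff_massMatrix i j).comp hq) (fun i => ?_) hx)
  have h1 := contDiff_mulVec_apply (A := fun x : Conf n × Conf n => (rob.comJac x.1)ᵀ)
    (v := fun x => rob.com x.1) (fun i j => (rob.contDiff_comJac j i).comp hq)
    (fun j => (rob.contDiff_com j).comp hq) i
  have h2 := contDiff_mulVec_apply (A := fun _ : Conf n × Conf n => KD)
    (fun _ _ => contDiff_const) hv i
  have h3 := contDiff_mulVec_apply (A := fun x : Conf n × Conf n => rob.coriolis x.1 x.2)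
    rob.contDiff_coriolis hv i
  exact ((contDiff_const.mul h1).neg.sub h2).sub h3

theorem contDiffAt_closedLoopField (κ : ℝ) (KD : Matrix (Coord n) (Coord n) ℝ)
    (j : Fin 3 ⊕ Fin 3 ⊕ Coord n) {x : Conf n × Conf n} (hx : (rob.massMatrix x.1).det ≠ 0) :
    ContDiffAt ℝ ∞ (closedLoopField rob κ KD j) x := by
  have hq : ContDiff ℝ ∞ fun x : Conf n × Conf n => x.1 := contDiff_fst
  refine contDiffAt_const.prodMk (contDiffAt_inv_mulVec
    (A := fun x : Conf n × Conf n => rob.massMatrix x.1)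
    (fun i j => (rob.contDiff_massMatrix i j).comp hq) (fun i => ?_) hx)
  rcases j with j | j | j
  · exact contDiff_const.mul ((rob.contDiff_comJac j i).comp hq)
  · exact contDiff_matrix_mul_apply (A := fun _ : Conf n × Conf n => KD)
      (B := fun x : Conf n × Conf n => (rob.comJac x.1)ᵀ) (fun _ _ => contDiff_const)
      (fun i j => (rob.contDiff_comJac j i).comp hq) i j
  · exact contDiff_const

/-- If no closed-loop solution leaves `X₁ × X₂`, then a global closed-loop solution exists. -/
theorem exists_isClosedLoopOn_Ici {grav h κ : ℝ} {KD : Matrix (Coord n) (Coord n) ℝ}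
    {K : Matrix (Fin 3) (Fin 3) ℝ} {X₁ : Set (Conf n × Conf n)} (hX₁ : IsCompact X₁)
    (hM : ∀ x ∈ X₁, (rob.massMatrix x.1).PosDef) {X₂ : Set V3} {X₃ : Set LipState}
    {U₃ : Set (Fin 2 → ℝ)} {D : Set (Conf n)} (hD : Bornology.IsBounded D) {d : ℝ → Conf n}
    (hd : IsDisturbanceSignal D d) {u₃ : ℝ → Fin 2 → ℝ} {x₃ : ℝ → LipState}
    (hx₃ : (lipModel grav h X₃ U₃).IsTrajectoryOn (Ici 0) u₃ (fun _ => ()) x₃)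
    {x₁₀ : Conf n × Conf n} {x₂₀ : V3} (hx₁₀ : x₁₀ ∈ X₁)
    (hcon : IsConstrained rob grav κ KD K X₁ X₂ x₃ d x₁₀ x₂₀) :
    ∃ x₁ x₂, IsClosedLoopOn rob grav κ KD K (Ici 0) x₃ d x₁ x₂ ∧ x₁ 0 = x₁₀ ∧ x₂ 0 = x₂₀ := by
  have hopen : IsOpen {x : Conf n × Conf n | (rob.massMatrix x.1).det ≠ 0} :=
    isOpen_ne_fun ((contDiff_det rob.contDiff_massMatrix).continuous.comp continuous_fst)
      continuous_const
  -- On this compact neighborhood of `X₁` the matrix `M` remains invertible, so the fields can be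
  -- replaced outside it by globally Lipschitz ones.
  obtain ⟨B, hB, hX₁B, hBdet⟩ := exists_compact_between hX₁ hopen fun x hx =>
    (hM x hx).isUnit.map Matrix.detMonoidHom |>.ne_zero
  obtain ⟨L₀, g₀, hg₀, he₀⟩ := hB.exists_lipschitzWith_eqOn fun x hx =>
    (contDiffAt_closedLoopDrift (rob := rob) κ KD (hBdet hx)).of_le (by simp)
  have hfield := fun j => hB.exists_lipschitzWith_eqOn fun x hx =>
    (contDiffAt_closedLoopField (rob := rob) κ KD j (hBdet hx)).of_le (by simp)
  choose L g hg he using hfield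
  -- The second component does not depend on `x₁`, so it is given explicitly and enters the
  -- whole-body equation as a known signal.
  set x₂ := lipTrack K x₃ (x₂₀ - lipPos (x₃ 0)) with hx₂
  set u₂ : ℝ → V3 := fun t => lipInterface K (x₂ t) (x₃ t) with hu₂
  have hx₂0 : x₂ 0 = x₂₀ := by rw [hx₂, lipTrack_zero, add_sub_cancel]
  have hx₃c := hx₃.continuousOn_Ici
  have hpc : ContinuousOn (fun t => lipPos (x₃ t)) (Ici 0) :=
    continuous_lipPos.comp_continuousOn hx₃c
  have hx₂c : ContinuousOn x₂ (Ici 0) :=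
    hpc.add (continuous_exp_smul_mulVec K _).continuousOn
  have hu₂c : ContinuousOn u₂ (Ici 0) :=
    (continuous_lipVel.comp_continuousOn hx₃c).add
      ((Continuous.matrix_mulVec continuous_const continuous_id).comp_continuousOn (hx₂c.sub hpc))
  set w : ℝ → Fin 3 ⊕ Fin 3 ⊕ Coord n → ℝ := fun t => Sum.elim (x₂ t) (Sum.elim (u₂ t) (d t))
    with hw
  have hwm : ∀ j, AEStronglyMeasurable (fun t => w t j) (volume.restrict (Ici 0)) := by
    rintro (j | j | j)
    · exact ((continuous_apply j).comp_continuousOn hx₂c).aestronglyMeasurable measurableSet_Ici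
    · exact ((continuous_apply j).comp_continuousOn hu₂c).aestronglyMeasurable measurableSet_Ici
    · exact ((measurable_pi_apply j).comp hd.1).aestronglyMeasurable
  have hwb : ∀ T, ∃ C, ∀ t ∈ Icc 0 T, ∀ j, |w t j| ≤ C := fun T => by
    obtain ⟨C₁, hC₁⟩ := isCompact_Icc.exists_bound_of_continuousOn
      (hx₂c.mono (fun t (ht : t ∈ Icc 0 T) => ht.1))
    obtain ⟨C₂, hC₂⟩ := isCompact_Icc.exists_bound_of_continuousOn
      (hu₂c.mono (fun t (ht : t ∈ Icc 0 T) => ht.1))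
    obtain ⟨C₃, hC₃⟩ := hD.exists_norm_le
    refine ⟨max C₁ (max C₂ C₃), fun t ht j => ?_⟩
    rcases j with j | j | j
    · exact ((norm_le_pi_norm (x₂ t) j).trans (hC₁ t ht)).trans (le_max_left _ _)
    · exact ((norm_le_pi_norm (u₂ t) j).trans (hC₂ t ht)).trans
        ((le_max_left _ _).trans (le_max_right _ _))
    · exact ((norm_le_pi_norm (d t) j).trans (hC₃ _ (hd.2 t ht.1))).trans
        ((le_max_right _ _).trans (le_max_right _ _))
  obtain ⟨x₁, hx₁c, hx₁0, hx₁⟩ := exists_solution_of_lipschitz_affine hg₀ hg hwm hwb x₁₀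
  have hF : ∀ s, x₁ s ∈ B → g₀ (x₁ s) + ∑ j, w s j • g j (x₁ s)
      = (wholeBodyModel rob grav univ univ).f (x₁ s)
        (energyInterface rob grav κ KD (x₁ s) (x₂ s) (u₂ s)) (d s) := fun s hs => by
    rw [wholeBodyModel_f_energyInterface, ← he₀ hs]
    congr 1
    exact Finset.sum_congr rfl fun j _ => by rw [← he j hs]
  have htraj : ∀ t, 0 ≤ t → (∀ s ∈ Icc 0 t, x₁ s ∈ B) →
      IntervalIntegrable (fun s => (wholeBodyModel rob grav univ univ).f (x₁ s)
        (energyInterface rob grav κ KD (x₁ s) (x₂ s) (u₂ s)) (d s)) volume 0 t ∧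
      x₁ t = x₁ 0 + ∫ s in (0 : ℝ)..t, (wholeBodyModel rob grav univ univ).f (x₁ s)
        (energyInterface rob grav κ KD (x₁ s) (x₂ s) (u₂ s)) (d s) := fun t ht hs => by
    obtain ⟨hi, heq⟩ := hx₁ t ht
    refine ⟨hi.congr fun s hs' => ?_, ?_⟩
    · rw [uIoc_of_le ht] at hs'
      exact hF s (hs s (Ioc_subset_Icc_self hs'))
    · rw [hx₁0, heq]
      congr 1
      refine intervalIntegral.integral_congr fun s hs' => ?_
      rw [uIcc_of_le ht] at hs'
      exact hF s (hs s hs')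
  have hx₂traj : comModel.IsTrajectoryOn (Ici 0) u₂ (fun _ => ()) x₂ :=
    isTrajectoryOn_lipTrack hx₃ _ _
  -- As long as `x₁` stays in `B` it solves the true closed loop, and the constraint then places it
  -- in `X₁`, which is interior to `B`.
  have hmem : ∀ t, 0 ≤ t → x₁ t ∈ X₁ := fun t ht => by
    refine forall_mem_of_forall_mem_interior hx₁c hX₁.isClosed hX₁B (by rwa [hx₁0])
      (fun T hT hBT t ht => ?_) ht
    refine (hcon T hT x₁ x₂ ⟨fun s hs => ?_, hx₂traj.mono Icc_subset_Ici_self⟩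
      hx₁0 hx₂0 t ht).1
    exact ⟨mem_univ _, mem_univ _, mem_univ _,
      htraj s hs.1 fun r hr => hBT r ⟨hr.1, hr.2.trans hs.2⟩⟩
  exact ⟨x₁, x₂, ⟨fun t ht => ⟨mem_univ _, mem_univ _, mem_univ _,
    htraj t ht fun s hs => interior_subset (hX₁B (hmem s hs.1))⟩, hx₂traj⟩, hx₁0, hx₂0⟩

end Existence

/-! ### The composed simulation -/

theorem theorem2 {n N : ℕ} (rob : Robot n N) (grav h : ℝ) (hgrav : 0 < grav) (hh : 0 < h)
    -- state, input and disturbance sets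
    (X₁ : Set (Conf n × Conf n)) (hX₁ : IsCompact X₁) (hX₁ne : X₁.Nonempty)
    (hM : ∀ x ∈ X₁, (rob.massMatrix x.1).PosDef)
    (X₂ : Set V3) (hX₂ : IsCompact X₂) (hX₂ne : X₂.Nonempty)
    (U₂ : Set V3) (hU₂ : Bornology.IsBounded U₂) (hU₂ne : U₂.Nonempty)
    (X₃ : Set LipState) (U₃ : Set (Fin 2 → ℝ))
    (D : Set (Conf n)) (hD : Bornology.IsBounded D) (hDne : D.Nonempty)
    -- gains of the energy shaping interface
    (κ : ℝ) (hκ : 0 < κ) (KD : Matrix (Coord n) (Coord n) ℝ) (hKD : KD.PosDef)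
    (α : ℝ) (hα : 0 < α) (hα' : α < 1 / √(κ * rob.totalMass / 2))
    (hαM : ∀ x ∈ X₁, ((1 / κ) • KD
      - α • ((rob.comJac x.1)ᵀ * rob.taskInertia x.1 * rob.comJac x.1)
      - α • rob.massMatrix x.1).PosSemidef)
    -- gain and precision of the linear interface
    (K : Matrix (Fin 3) (Fin 3) ℝ) (hK : IsHurwitz K) (ε₂ : ℝ) (hε₂ : 0 < ε₂)
    (hKU : ∀ x₂ ∈ X₂, ∀ x₃ ∈ X₃, ‖comModel.g x₂ - (lipModel grav h X₃ U₃).g x₃‖ ≤ ε₂ →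
      lipInterface K x₂ x₃ ∈ U₂) :
    ∃ β S : ℝ, 0 < β ∧
      -- `β` is the minimal eigenvalue of `P` over `X₁`, and `S` is the supremum of `OT`
      IsLeast {b | ∃ x ∈ X₁,
        Module.End.HasEigenvalue (Matrix.toLin' (lyapMatrix rob κ α x.1)) b} β ∧
      IsLUB {r | ∃ x₁ ∈ X₁, ∃ x₂ ∈ X₂, ∃ u₂ ∈ U₂, ∃ τ ∈ D,
        r = otherTerms rob κ α KD x₁ x₂ u₂ τ} S ∧
      -- the relation contains the rest states, with `x₂` at the center of mass
      (∀ q, (q, 0) ∈ X₁ → rob.com q ∈ X₂ → lyapRel rob κ α S X₁ X₂ (q, 0) (rob.com q)) ∧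
      ∃ R₂₃ : V3 → LipState → Prop,
        -- the center of mass model simulates the pendulum with precision `ε₂`, by the interface
        IsRobustApproxSimRel comModel (lipModel grav h univ univ) R₂₃ ε₂ ∧
        (∃ δ > 0, ∀ x₂ x₃, ‖comModel.g x₂ - (lipModel grav h X₃ U₃).g x₃‖ ≤ δ → R₂₃ x₂ x₃) ∧
        (∀ u₃ x₃, (lipModel grav h univ univ).IsTrajectoryOn (Ici 0) u₃ (fun _ => ()) x₃ →
          ∀ T, 0 ≤ T → ∀ x₂, comModel.IsTrajectoryOn (Icc 0 T)
              (fun t => lipInterface K (x₂ t) (x₃ t)) (fun _ => ()) x₂ →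
            R₂₃ (x₂ 0) (x₃ 0) → ∀ t ∈ Icc 0 T, R₂₃ (x₂ t) (x₃ t)) ∧
        -- the composed interfaces keep the outputs close, for all disturbances
        (∀ d, IsDisturbanceSignal D d →
          ∀ u₃ x₃, (lipModel grav h X₃ U₃).IsTrajectoryOn (Ici 0) u₃ (fun _ => ()) x₃ →
          ∀ x₁₀ x₂₀, lyapRel rob κ α S X₁ X₂ x₁₀ x₂₀ → R₂₃ x₂₀ (x₃ 0) →
            (∀ T, 0 ≤ T → ∀ x₁ x₂, IsClosedLoopOn rob grav κ KD K (Icc 0 T) x₃ d x₁ x₂ →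
              x₁ 0 = x₁₀ → x₂ 0 = x₂₀ → (∀ t ∈ Icc 0 T, x₁ t ∈ X₁ ∧ x₂ t ∈ X₂) →
              ∀ t ∈ Icc 0 T,
                lyapRel rob κ α S X₁ X₂ (x₁ t) (x₂ t) ∧ R₂₃ (x₂ t) (x₃ t) ∧
                ‖(wholeBodyModel rob grav X₁ D).g (x₁ t) - comModel.g (x₂ t)‖
                  ≤ √(1 / β * (S / (2 * α * κ))) ∧
                ‖comModel.g (x₂ t) - (lipModel grav h X₃ U₃).g (x₃ t)‖ ≤ ε₂ ∧
                ‖(wholeBodyModel rob grav X₁ D).g (x₁ t) - (lipModel grav h X₃ U₃).g (x₃ t)‖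
                  ≤ √(1 / β * (S / (2 * α * κ))) + ε₂) ∧
            (IsConstrained rob grav κ KD K X₁ X₂ x₃ d x₁₀ x₂₀ →
              ∃ x₁ x₂, IsClosedLoopOn rob grav κ KD K (Ici 0) x₃ d x₁ x₂ ∧
                x₁ 0 = x₁₀ ∧ x₂ 0 = x₂₀)) ∧
        -- the whole-body model robustly approximately simulates the pendulum
        ((∀ d, IsDisturbanceSignal D d →
          ∀ u₃ x₃, (lipModel grav h X₃ U₃).IsTrajectoryOn (Ici 0) u₃ (fun _ => ()) x₃ →
          ∀ x₁₀ x₂₀, lyapRel rob κ α S X₁ X₂ x₁₀ x₂₀ → R₂₃ x₂₀ (x₃ 0) →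
            IsConstrained rob grav κ KD K X₁ X₂ x₃ d x₁₀ x₂₀) →
          IsRobustApproxSimRel (wholeBodyModel rob grav X₁ D) (lipModel grav h X₃ U₃)
            (fun x₁ x₃ => ∃ x₂, lyapRel rob κ α S X₁ X₂ x₁ x₂ ∧ R₂₃ x₂ x₃)
            (√(1 / β * (S / (2 * α * κ))) + ε₂)) := by
  have hKDt : KDᵀ = KD := by simpa using hKD.isHermitian.eq
  obtain ⟨β, hβ, hleast, hlow⟩ :=
    exists_isLeast_eigenvalue_lyapMatrix hX₁ hX₁ne hM hκ hα hα'
  obtain ⟨S, hS⟩ := exists_isLUB_otherTerms (κ := κ) (α := α) hKDt hX₁ hX₁ne hM hX₂ hX₂ne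
    hU₂ hU₂ne hD hDne
  have hstatic : ∀ x₁ x₂ x₃, lyapRel rob κ α S X₁ X₂ x₁ x₂ → lipRel K ε₂ x₂ x₃ →
      ‖(wholeBodyModel rob grav X₁ D).g x₁ - comModel.g x₂‖ ≤ √(1 / β * (S / (2 * α * κ))) ∧
      ‖comModel.g x₂ - (lipModel grav h X₃ U₃).g x₃‖ ≤ ε₂ ∧
      ‖(wholeBodyModel rob grav X₁ D).g x₁ - (lipModel grav h X₃ U₃).g x₃‖
        ≤ √(1 / β * (S / (2 * α * κ))) + ε₂ := by
    rintro x₁ x₂ x₃ ⟨hx₁, -, hV⟩ hR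
    have h₁ : ‖(wholeBodyModel rob grav X₁ D).g x₁ - comModel.g x₂‖
        ≤ √(1 / β * (S / (2 * α * κ))) := norm_sub_le_of_lyapFn_le hβ (hlow x₁ hx₁) hV
    have h₂ : ‖comModel.g x₂ - (lipModel grav h X₃ U₃).g x₃‖ ≤ ε₂ := hR.norm_sub_le
    exact ⟨h₁, h₂, (norm_sub_le_norm_sub_add_norm_sub _ _ _).trans (add_le_add h₁ h₂)⟩
  have hinv : ∀ d, IsDisturbanceSignal D d →
      ∀ u₃ x₃, (lipModel grav h X₃ U₃).IsTrajectoryOn (Ici 0) u₃ (fun _ => ()) x₃ →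
      ∀ x₁₀ x₂₀, lyapRel rob κ α S X₁ X₂ x₁₀ x₂₀ → lipRel K ε₂ x₂₀ (x₃ 0) →
      ∀ T, 0 ≤ T → ∀ x₁ x₂, IsClosedLoopOn rob grav κ KD K (Icc 0 T) x₃ d x₁ x₂ →
        x₁ 0 = x₁₀ → x₂ 0 = x₂₀ → (∀ t ∈ Icc 0 T, x₁ t ∈ X₁ ∧ x₂ t ∈ X₂) →
        ∀ t ∈ Icc 0 T, lyapRel rob κ α S X₁ X₂ (x₁ t) (x₂ t) ∧ lipRel K ε₂ (x₂ t) (x₃ t) := by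
    rintro d hd u₃ x₃ hx₃ _ _ hV hR T hT x₁ x₂ hcl rfl rfl hmem
    have hR' : ∀ t ∈ Icc 0 T, lipRel K ε₂ (x₂ t) (x₃ t) := fun t ht =>
      hR.of_isTrajectoryOn ht.1 (hx₃.mono Icc_subset_Ici_self)
        (hcl.2.mono (Icc_subset_Icc_right ht.2))
    refine fun t ht => ⟨⟨(hmem t ht).1, (hmem t ht).2, ?_⟩, hR' t ht⟩
    have hsub : Icc 0 t ⊆ Icc 0 T := Icc_subset_Icc_right ht.2
    refine lyapFn_le_of_isClosedLoopOn hκ hα hKDt ht.1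
      ⟨hcl.1.mono hsub, hcl.2.mono hsub⟩ (fun s hs => hM _ (hmem s (hsub hs)).1)
      (fun s hs => hαM _ (hmem s (hsub hs)).1) (fun s hs => ?_) hV.2.2
    -- `S` bounds the residual only for `u₂ ∈ U₂`. The second relation supplies the precision `ε₂`
    -- under which the interface takes values there.
    exact hS.1 ⟨_, (hmem s (hsub hs)).1, _, (hmem s (hsub hs)).2, _,
      hKU _ (hmem s (hsub hs)).2 _ (hx₃ s hs.1).1 (hR' s (hsub hs)).norm_sub_le, _,
      hd.2 s hs.1, rfl⟩
  refine ⟨β, S, hβ, hleast, hS, fun q hq hcom => ⟨hq, hcom, ?_⟩, lipRel K ε₂,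
    isRobustApproxSimRel_lipRel ε₂, exists_lipRel_of_norm_le hK hε₂,
    fun u₃ x₃ hx₃ T hT x₂ hx₂ hR t ht => ?_, fun d hd u₃ x₃ hx₃ x₁₀ x₂₀ hV hR => ⟨?_, ?_⟩, ?_⟩
  -- At rest with `x₂` at the center of mass both `𝒱` and the residual vanish. The latter gives `S ≥
  -- 0`, so the sublevel set contains this state.
  · obtain ⟨u, hu⟩ := hU₂ne
    obtain ⟨τ, hτ⟩ := hDne
    have hS0 : 0 ≤ S := hS.1 ⟨_, hq, _, hcom, u, hu, τ, hτ,
      (otherTerms_rest hKDt (hM _ hq) u τ).symm⟩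
    rw [lyapFn_rest (hM _ hq)]
    positivity
  · exact hR.of_isTrajectoryOn ht.1 (hx₃.mono Icc_subset_Ici_self)
      (hx₂.mono (Icc_subset_Icc_right ht.2))
  · intro T hT x₁ x₂ hcl h₁ h₂ hmem t ht
    obtain ⟨hV', hR'⟩ := hinv d hd u₃ x₃ hx₃ _ _ hV hR T hT x₁ x₂ hcl h₁ h₂ hmem t ht
    exact ⟨hV', hR', hstatic _ _ _ hV' hR'⟩
  · exact exists_isClosedLoopOn_Ici hX₁ hM hD hd hx₃ hV.1
  · rintro hcon x₁₀ x₃₀ ⟨x₂₀, hV, hR⟩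
    refine ⟨(hstatic _ _ _ hV hR).2.2, fun d hd u₃ x₃ hx₃ h0 => ?_⟩
    subst h0
    have hc := hcon d hd u₃ x₃ hx₃ _ _ hV hR
    obtain ⟨x₁, x₂, hcl, h₁, h₂⟩ := exists_isClosedLoopOn_Ici hX₁ hM hD hd hx₃ hV.1 hc
    have hclT : ∀ T, IsClosedLoopOn rob grav κ KD K (Icc 0 T) x₃ d x₁ x₂ := fun T =>
      ⟨hcl.1.mono Icc_subset_Ici_self, hcl.2.mono Icc_subset_Ici_self⟩
    have hmem : ∀ T, 0 ≤ T → ∀ t ∈ Icc 0 T, x₁ t ∈ X₁ ∧ x₂ t ∈ X₂ := fun T hT =>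
      hc T hT x₁ x₂ (hclT T) h₁ h₂
    -- The simulating input is the feedback evaluated along the closed-loop solution, and `x₂ t`
    -- witnesses the composed relation.
    refine ⟨fun t => energyInterface rob grav κ KD (x₁ t) (x₂ t) (lipInterface K (x₂ t) (x₃ t)),
      x₁, fun t ht => ?_, h₁, fun t ht => ⟨x₂ t, ?_⟩⟩
    · obtain ⟨-, -, -, hint, heq⟩ := hcl.1 t ht
      exact ⟨(hmem t ht t ⟨ht, le_rfl⟩).1, mem_univ _, hd.2 t ht, hint, heq⟩
    · exact hinv d hd u₃ x₃ hx₃ _ _ hV hR t ht x₁ x₂ (hclT t) h₁ h₂ (hmem t ht) t ⟨ht, le_rfl⟩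

end
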